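/- Let $\Gamma$ be a finite simple graph with node set $V$, $n=|V|$. A *tube* of $\Gamma$ is a nonempty proper subset $t\subsetneq V$ whose induced subgraph $\Gamma_t$ is connected. Two tubes are *compatible* if they are nested or disjoint, and are not disjoint with a tube as their union. A *tubing* is a set of pairwise compatible tubes; a *$k$-tubing* is a tubing with $k$ tubes. For a tube $t$, the *reconnected complement* $\Gamma^*_t$ is the graph on $V\setminus t$ in which $a\neq b$ are joined if and only if $\{a,b\}$ or $\{a,b\}\cup t$ induces a connected subgraph of $\Gamma$. Let $\triangle_\Gamma=\{x\in\mathbb R^V : x_v\ge 0,\ \sum_v x_v=1\}$ be the $(n-1)$-simplex whose facets $\{x_v=0\}$ are labelled by the nodes, and for $t\subsetneq V$ let $f_t=\{x\in\triangle_\Gamma : x_v=0 \text{ for all } v\in t\}$. *Truncating* a polytope $P$ at a face $F$ means replacing it by $P\cap\{x:\ell(x)\ge c\}$, where $\ell$ is a linear functional and $c$ a real number such that $\ell<c$ at every vertex of $P$ in $F$ and $\ell>c$ at every vertex of $P$ not in $F$. A *graph-associahedron* $\mathcal P\Gamma$ is a polytope obtained from $\triangle_\Gamma$ by listing all tubes of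 $\Gamma$, each once, in an order in which the dimensions of the faces $f_t$ are non-decreasing, and successively truncating, for each tube $t$ in this order, the polytope $P$ obtained so far at $P\cap f_t$; write $H_t=\{\ell_t=c_t\}$ for the hyperplane used for $t$. The face poset of a polytope is the set of its nonempty faces (the polytope itself included) ordered by inclusion; a facet is a face of codimension one; two polytopes are *combinatorially equivalent* if their face posets are isomorphic. **Theorem.** A graph-associahedron $\mathcal P\Gamma$ exists. For every graph-associahedron $\mathcal P\Gamma$ of $\Gamma$ (any admissible order and any choice of truncating half-spaces), the map $\{t\}\mapsto \mathcal P\Gamma\cap H_t$ is a bijection from the $1$-tubings of $\Gamma$ onto the facets of $\mathcal P\Gamma$. Moreover, for every tube $t$, the facet $\mathcal P\Gamma\cap H_t$ associated to $\{t\}$ is combinatorially equivalent to the product $\mathcal P\Gamma_t\times\mathcal P\Gamma^*_t$, for all graph-associahedra $\mathcal P\Gamma_t$ of $\Gamma_t$ and $\mathcal P\Gamma^*_t$ of $\Gamma^*_t$. -/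

import Mathlib

/-! ## Tubes and tubings of a finite graph -/

/-- A tube of `G`: a proper nonempty set of nodes whose induced subgraph is connected. -/
def IsTube {V : Type*} [Fintype V] (G : SimpleGraph V) (t : Finset V) : Prop :=
  t.Nonempty ∧ t ≠ Finset.univ ∧ (G.induce {v | v ∈ t}).Connected

/-- Two tubes are compatible if they neither intersect (overlap without being nested)
nor are adjacent (are disjoint with a tube as union). -/
def CompatibleTubes {V : Type*} [Fintype V] [DecidableEq V] (G : SimpleGraph V)
    (s t : Finset V) : Prop :=
  ¬ ((s ∩ t).Nonempty ∧ ¬ s ⊆ t ∧ ¬ t ⊆ s) ∧ ¬ (Disjoint s t ∧ IsTube G (s ∪ t))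

/-- A tubing of `G`: a set of pairwise compatible tubes. -/
def IsTubing {V : Type*} [Fintype V] [DecidableEq V] (G : SimpleGraph V)
    (T : Finset (Finset V)) : Prop :=
  (∀ t ∈ T, IsTube G t) ∧ ∀ s ∈ T, ∀ t ∈ T, s ≠ t → CompatibleTubes G s t

/-- A `k`-tubing: a tubing with exactly `k` tubes. -/
def IsKTubing {V : Type*} [Fintype V] [DecidableEq V] (G : SimpleGraph V) (k : ℕ)
    (T : Finset (Finset V)) : Prop :=
  IsTubing G T ∧ T.card = k

/-- The subgraph of `G` induced on the node set `t`. -/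
def tubeGraph {V : Type*} (G : SimpleGraph V) (t : Finset V) : SimpleGraph {v // v ∈ t} :=
  G.induce {v | v ∈ t}

/-- The reconnected complement of `t` in `G`: its nodes are those outside `t`, and distinct nodes
`a`, `b` are joined if `{a, b}` or `{a, b} ∪ t` induces a connected subgraph of `G`. -/
def reconnectedComplement {V : Type*} (G : SimpleGraph V) (t : Finset V) :
    SimpleGraph {v // v ∉ t} where
  Adj a b := a ≠ b ∧
    ((G.induce ({a.1, b.1} : Set V)).Connected ∨
      (G.induce (({a.1, b.1} : Set V) ∪ {v | v ∈ t})).Connected)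
  symm := ⟨fun a b h => by
    rw [Set.pair_comm b.1 a.1]
    exact ⟨h.1.symm, h.2⟩⟩
  loopless := ⟨fun _ h => h.1 rfl⟩

/-! ## Faces of polytopes -/

/-- `F` is a nonempty face of `P`: the nonempty set of maximizers on `P` of some linear functional
(`P` itself, which is exposed by the zero functional, counts as a face). -/
def IsFace {E : Type*} [AddCommGroup E] [Module ℝ E] [TopologicalSpace E]
    (P F : Set E) : Prop :=
  F.Nonempty ∧ IsExposed ℝ P F

/-- The poset of nonempty faces of `P`, ordered by inclusion (as a subtype of `Set E`). -/
abbrev FacePoset {E : Type*} [AddCommGroup E] [Module ℝ E] [TopologicalSpace E]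
    (P : Set E) : Type _ :=
  {F : Set E // IsFace P F}

/-- A facet of `P` is a face of codimension one. -/
def IsFacet {E : Type*} [AddCommGroup E] [Module ℝ E] [TopologicalSpace E]
    (P F : Set E) : Prop :=
  IsFace P F ∧
    Module.finrank ℝ (vectorSpan ℝ F) + 1 = Module.finrank ℝ (vectorSpan ℝ P)

/-- Two polytopes are combinatorially equivalent if their face posets are isomorphic. -/
def CombinatoriallyEquivalent {E E' : Type*}
    [AddCommGroup E] [Module ℝ E] [TopologicalSpace E]
    [AddCommGroup E'] [Module ℝ E'] [TopologicalSpace E'] (P : Set E) (P' : Set E') : Prop :=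
  Nonempty (FacePoset P ≃o FacePoset P')

/-! ## Truncations and graph-associahedra -/

/-- The half-space `{x | c ≤ ℓ x}` truncates the polytope `P` at its face `F`: the vertices of `P`
lying in `F` are strictly outside it, all the other vertices of `P` are in its interior.
The truncated polytope is then `P ∩ {x | c ≤ ℓ x}`. -/
def TruncatesAt {E : Type*} [AddCommGroup E] [Module ℝ E] (P F : Set E)
    (ℓ : E →ₗ[ℝ] ℝ) (c : ℝ) : Prop :=
  ∀ x ∈ P.extremePoints ℝ, (x ∈ F → ℓ x < c) ∧ (x ∉ F → c < ℓ x)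

/-- The simplex with facets labelled by the nodes is `stdSimplex ℝ V`, the facet of the node `v`
being `x v = 0`. This is the face of a set `t` of nodes: the intersection of their facets;
its dimension is `|V| - 1 - |t|` for proper `t`. -/
def simplexFace {V : Type*} [Fintype V] (t : Finset V) : Set (V → ℝ) :=
  {x | x ∈ stdSimplex ℝ V ∧ ∀ v ∈ t, x v = 0}

/-- What remains of the simplex after cutting, for every `t` in the list `L`,
with the half-space `{x | level t ≤ normal t x}`. -/
def cutSimplex {V : Type*} [Fintype V] (normal : Finset V → ((V → ℝ) →ₗ[ℝ] ℝ))
    (level : Finset V → ℝ) (L : List (Finset V)) : Set (V → ℝ) :=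
  {x | x ∈ stdSimplex ℝ V ∧ ∀ t ∈ L, level t ≤ normal t x}

/-- A construction of the graph-associahedron of `G`: the tubes of `G` are listed so that the
dimensions of the corresponding faces of the simplex increase (weakly), i.e. the sizes of the tubes
decrease (weakly), and these faces are truncated successively in that order. At the step of the
tube `t`, the polytope obtained so far is truncated by the half-space
`{x | level t ≤ normal t x}` at what is left of the face of `t`. -/
structure GraphAssociahedron {V : Type*} [Fintype V] (G : SimpleGraph V) where
  order : List (Finset V)
  nodup : order.Nodup
  mem_order : ∀ t, t ∈ order ↔ IsTube G t
  sorted : order.Pairwise (fun s t => t.card ≤ s.card)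
  normal : Finset V → ((V → ℝ) →ₗ[ℝ] ℝ)
  level : Finset V → ℝ
  truncates : ∀ (L₁ : List (Finset V)) (t : Finset V) (L₂ : List (Finset V)),
    order = L₁ ++ t :: L₂ →
      TruncatesAt (cutSimplex normal level L₁) (cutSimplex normal level L₁ ∩ simplexFace t)
        (normal t) (level t)

/-- The graph-associahedron itself: the simplex after all truncations. -/
def GraphAssociahedron.polytope {V : Type*} [Fintype V] {G : SimpleGraph V}
    (D : GraphAssociahedron G) : Set (V → ℝ) :=
  cutSimplex D.normal D.level D.order

/-- The part of the graph-associahedron that is associated to a set `T` of tubes: its intersection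
with the hyperplanes by which the faces of the tubes in `T` have been truncated. -/
def GraphAssociahedron.tubingFace {V : Type*} [Fintype V] {G : SimpleGraph V}
    (D : GraphAssociahedron G) (T : Finset (Finset V)) : Set (V → ℝ) :=
  {x | x ∈ D.polytope ∧ ∀ t ∈ T, D.normal t x = D.level t}

/-! A point of a polytope given by inequalities is labelled by the set of inequalities tight at it.
The faces are the sets of points whose label contains a given occurring label, so the face poset is
the opposite of the poset of occurring labels, and everything reduces to finding these label sets.

One truncation changes the labels by a stellar subdivision (`exists_tightSet_insert_eq_iff`). On the
combinatorial side, adjoining a set `t` to a family `B` changes its nested families in the same way,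
provided that `t` is not larger than the members of `B` and that unions of members with `t` which
they meet stay under control (`isNestedFamily_insert_iff`). Tubes taken in weakly decreasing size
meet these conditions, since the union of two intersecting tubes is connected. Starting from the
simplex, whose labels are the proper sets of nodes, induction shows that after all truncations the
occurring labels are exactly the nested tubings (`image_tightTubes`). This holds for every order and
every choice of half-spaces.

Nestedness is stronger than pairwise compatibility: two disjoint tubes covering all nodes may be
compatible, but their hyperplanes have no common point on the polytope. A single tube is always
nested, and the facets are the faces of single tubes by a dimension count.

For the product structure, the labels on the facet of `t` are the nested tubings containing `t`.
Such a tubing splits into its tubes strictly inside `t`, a nested tubing of the induced subgraph,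
and the tubes not inside `t`. Removing `t` from the latter gives a nested tubing of the reconnected
complement; in the inverse direction `t` is added to a tube exactly when the result is connected
(`liftTube`). This is the order isomorphism `linkOrderIso`. Existence follows by cutting with
coordinate sums at small positive levels chosen one after another. -/

/-! ## Face labelings -/

/-- A labeling of the points of a convex set by an ordered set in such a way that the faces
are the sets of points whose label exceeds a given one. -/
structure FaceLabeling {E L : Type*} [AddCommGroup E] [Module ℝ E] [TopologicalSpace E]
    [PartialOrder L] (P : Set E) (a : E → L) : Prop where
  convex : Convex ℝ P
  finite : (a '' P).Finite
  midpoint_le : ∀ x ∈ P, ∀ y ∈ P, a (midpoint ℝ x y) ≤ a x ∧ a (midpoint ℝ x y) ≤ a y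
  extend : ∀ x ∈ P, ∀ y ∈ P, a x ≤ a y →
    ∀ᶠ ε in nhdsWithin (0 : ℝ) (Set.Ioi 0), x + ε • (x - y) ∈ P
  exposed : ∀ x ∈ P, IsExposed ℝ P {y | y ∈ P ∧ a x ≤ a y}

namespace FaceLabeling

section

variable {E L L' : Type*} [AddCommGroup E] [Module ℝ E] [TopologicalSpace E]
  [PartialOrder L] [PartialOrder L'] {P : Set E} {a : E → L}

theorem isFace (h : FaceLabeling P a) {x : E} (hx : x ∈ P) :
    IsFace P {y | y ∈ P ∧ a x ≤ a y} :=
  ⟨⟨x, hx, le_rfl⟩, h.exposed x hx⟩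

theorem exists_eq_of_isFace (h : FaceLabeling P a) {F : Set E} (hF : IsFace P F) :
    ∃ x ∈ F, x ∈ P ∧ F = {y | y ∈ P ∧ a x ≤ a y} := by
  obtain ⟨hne, hex⟩ := hF
  obtain ⟨l, rfl⟩ := hex hne
  set F : Set E := {x | x ∈ P ∧ ∀ y ∈ P, l y ≤ l x} with hFdef
  have hfin : (a '' F).Finite := h.finite.subset (Set.image_mono fun x hx => hx.1)
  -- A point of `F` with minimal label plays the role of a relative interior point: its midpoint
  -- with any `y ∈ F` stays in `F` and has a label below both, so minimality puts its label below
  -- that of `y`.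
  obtain ⟨m, hm⟩ := hfin.exists_minimal (hne.image a)
  obtain ⟨x, hxF, rfl⟩ := hm.prop
  refine ⟨x, hxF, hxF.1, Set.Subset.antisymm ?_ ?_⟩
  · intro y hy
    refine ⟨hy.1, ?_⟩
    have hmid : midpoint ℝ x y ∈ F := by
      refine ⟨h.convex.midpoint_mem hxF.1 hy.1, fun z hz => ?_⟩
      have h1 := hxF.2 z hz
      have h2 := hy.2 z hz
      rw [midpoint_eq_smul_add]
      simp only [map_smul, map_add, smul_eq_mul, invOf_eq_inv]
      linarith
    have h1 := h.midpoint_le x hxF.1 y hy.1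
    exact (hm.le_of_le ⟨_, hmid, rfl⟩ h1.1).trans h1.2
  · rintro y ⟨hy, hxy⟩
    refine ⟨hy, fun z hz => ?_⟩
    -- The segment from `y` to `x` extends beyond `x` inside `P`; as `l` is maximal at `x`, it
    -- cannot be smaller at `y`.
    obtain ⟨ε, hε, hpos⟩ := ((h.extend x hxF.1 y hy hxy).and self_mem_nhdsWithin).exists
    have h1 := hxF.2 _ hε
    simp only [map_add, map_smul, map_sub, smul_eq_mul] at h1
    have hpos : 0 < ε := hpos
    have h2 : l x ≤ l y := by
      by_contra hlt
      have := mul_pos hpos (sub_pos.2 (not_le.1 hlt))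
      linarith
    exact (hxF.2 z hz).trans h2

/-- The poset of faces is opposite to the poset of labels. -/
theorem nonempty_orderIso (h : FaceLabeling P a) : Nonempty ((a '' P)ᵒᵈ ≃o FacePoset P) := by
  let f : (a '' P)ᵒᵈ → FacePoset P := fun m =>
    ⟨{y | y ∈ P ∧ (OrderDual.ofDual m).1 ≤ a y}, by
      obtain ⟨x, hx, hxm⟩ := (OrderDual.ofDual m).2
      rw [← hxm]
      exact h.isFace hx⟩
  have hf : ∀ m n, f m ≤ f n ↔ m ≤ n := by
    intro m n
    constructor
    · intro hmn
      obtain ⟨x, hx, hxm⟩ := (OrderDual.ofDual m).2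
      have := hmn (show x ∈ (f m).1 from ⟨hx, hxm.ge⟩)
      exact this.2.trans hxm.le
    · intro hmn y hy
      exact ⟨hy.1, le_trans (show (OrderDual.ofDual n).1 ≤ (OrderDual.ofDual m).1 from hmn) hy.2⟩
  refine ⟨RelIso.ofSurjective (OrderEmbedding.ofMapLEIff f hf) ?_⟩
  rintro ⟨F, hF⟩
  obtain ⟨x, -, hx, rfl⟩ := h.exists_eq_of_isFace hF
  exact ⟨OrderDual.toDual ⟨a x, x, hx, rfl⟩, rfl⟩

/-- Only the comparison of labels on `P` matters. This allows the node inequalities to be dropped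
from the labels once they are known never to be tight. -/
theorem relabel (h : FaceLabeling P a) {b : E → L'}
    (hab : ∀ x ∈ P, ∀ y ∈ P, a x ≤ a y ↔ b x ≤ b y) (hfin : (b '' P).Finite) :
    FaceLabeling P b where
  convex := h.convex
  finite := hfin
  midpoint_le x hx y hy := by
    have hm := h.convex.midpoint_mem hx hy
    rw [← hab _ hm x hx, ← hab _ hm y hy]
    exact h.midpoint_le x hx y hy
  extend x hx y hy hxy := h.extend x hx y hy ((hab x hx y hy).2 hxy)
  exposed x hx := by
    convert h.exposed x hx using 1
    ext y
    exact and_congr_right fun hy => (hab x hx y hy).symm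

theorem of_isFace (h : FaceLabeling P a) {F : Set E} (hF : IsFace P F) : FaceLabeling F a := by
  obtain ⟨hne, hex⟩ := hF
  obtain ⟨l, rfl⟩ := hex hne
  set F : Set E := {x | x ∈ P ∧ ∀ y ∈ P, l y ≤ l x} with hFdef
  have hconv : Convex ℝ F := by
    intro x hx y hy s t hs ht hst
    refine ⟨h.convex hx.1 hy.1 hs ht hst, fun z hz => ?_⟩
    have h1 := mul_le_mul_of_nonneg_left (hx.2 z hz) hs
    have h2 := mul_le_mul_of_nonneg_left (hy.2 z hz) ht
    simp only [map_add, map_smul, smul_eq_mul]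
    have h3 : l z = s * l z + t * l z := by rw [← add_mul, hst, one_mul]
    linarith
  refine ⟨hconv, h.finite.subset (Set.image_mono fun x hx => hx.1),
    fun x hx y hy => h.midpoint_le x hx.1 y hy.1, fun x hx y hy hxy => ?_, fun x hx => ?_⟩
  · filter_upwards [h.extend x hx.1 y hy.1 hxy] with ε hε
    refine ⟨hε, fun z hz => ?_⟩
    have h1 := hx.2 z hz
    have h2 : l x = l y := le_antisymm (hy.2 x hx.1) (hx.2 y hy.1)
    simpa [h2] using (h2 ▸ h1)
  · have hx' := h.exposed x hx.1
    have hF : IsExposed ℝ P F := fun _ => ⟨l, rfl⟩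
    have hI := (hx'.inter hF).mono (B := F) (fun y hy => hy.1) fun y hy => hy.2
    have e : {y | y ∈ F ∧ a x ≤ a y} = {y | y ∈ P ∧ a x ≤ a y} ∩ F := by
      ext y
      exact ⟨fun hy => ⟨⟨hy.1.1, hy.2⟩, hy.1⟩, fun hy => ⟨hy.2, hy.1.2⟩⟩
    rw [e]
    exact hI

theorem prod {E' : Type*} [AddCommGroup E'] [Module ℝ E'] [TopologicalSpace E']
    (h : FaceLabeling P a) {P' : Set E'} {b : E' → L'} (h' : FaceLabeling P' b) :
    FaceLabeling (P ×ˢ P') (Prod.map a b) where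
  convex := h.convex.prod h'.convex
  finite := by
    rw [Set.prodMap_image_prod]
    exact h.finite.prod h'.finite
  midpoint_le x hx y hy := by
    have h1 := h.midpoint_le x.1 hx.1 y.1 hy.1
    have h2 := h'.midpoint_le x.2 hx.2 y.2 hy.2
    have e : midpoint ℝ x y = (midpoint ℝ x.1 y.1, midpoint ℝ x.2 y.2) := by
      simp only [midpoint_eq_smul_add]
      rfl
    rw [e]
    exact ⟨⟨h1.1, h2.1⟩, h1.2, h2.2⟩
  extend x hx y hy hxy := by
    filter_upwards [h.extend x.1 hx.1 y.1 hy.1 hxy.1, h'.extend x.2 hx.2 y.2 hy.2 hxy.2]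
      with ε h1 h2
    exact ⟨h1, h2⟩
  exposed x hx := by
    obtain ⟨l, hl⟩ := h.exposed x.1 hx.1 ⟨x.1, hx.1, le_rfl⟩
    obtain ⟨l', hl'⟩ := h'.exposed x.2 hx.2 ⟨x.2, hx.2, le_rfl⟩
    intro _
    refine ⟨l.comp (ContinuousLinearMap.fst ℝ E E') + l'.comp (ContinuousLinearMap.snd ℝ E E'), ?_⟩
    ext y
    have e1 := Set.ext_iff.1 hl
    have e2 := Set.ext_iff.1 hl'
    simp only [Set.mem_ofPred_eq] at e1 e2
    have hx1 := (e1 x.1).1 ⟨hx.1, le_rfl⟩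
    have hx2 := (e2 x.2).1 ⟨hx.2, le_rfl⟩
    simp only [Set.mem_ofPred_eq, Set.mem_prod, add_apply,
      ContinuousLinearMap.comp_apply, ContinuousLinearMap.coe_fst',
      ContinuousLinearMap.coe_snd']
    constructor
    · rintro ⟨⟨hy1, hy2⟩, hle⟩
      refine ⟨⟨hy1, hy2⟩, fun z hz => ?_⟩
      have h1 := ((e1 y.1).1 ⟨hy1, hle.1⟩).2 z.1 hz.1
      have h2 := ((e2 y.2).1 ⟨hy2, hle.2⟩).2 z.2 hz.2
      exact add_le_add h1 h2
    · rintro ⟨⟨hy1, hy2⟩, hmax⟩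
      have h1 := hmax (x.1, y.2) ⟨hx.1, hy2⟩
      have h2 := hmax (y.1, x.2) ⟨hy1, hx.2⟩
      simp only at h1 h2
      refine ⟨⟨hy1, hy2⟩, ((e1 y.1).2 ⟨hy1, fun z hz => ?_⟩).2,
        ((e2 y.2).2 ⟨hy2, fun z hz => ?_⟩).2⟩
      · linarith [hx1.2 z hz]
      · linarith [hx2.2 z hz]

theorem combinatoriallyEquivalent {E' : Type*} [AddCommGroup E'] [Module ℝ E']
    [TopologicalSpace E'] (h : FaceLabeling P a) {P' : Set E'} {b : E' → L'}
    (h' : FaceLabeling P' b) (e : a '' P ≃o b '' P') : CombinatoriallyEquivalent P P' := by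
  obtain ⟨f⟩ := h.nonempty_orderIso
  obtain ⟨f'⟩ := h'.nonempty_orderIso
  exact ⟨f.symm.trans (e.dual.trans f')⟩

/-- Labels separate extreme points: if `x` and `y` have the same label, the segment from `y` to `x`
extends beyond `x`, which is impossible for an extreme `x ≠ y`. -/
theorem finite_extremePoints (h : FaceLabeling P a) : (P.extremePoints ℝ).Finite := by
  refine Set.Finite.of_finite_image (h.finite.subset (Set.image_mono fun x hx => hx.1)) ?_
  intro x hx y hy hxy
  obtain ⟨ε, hε, hpos⟩ := ((h.extend x hx.1 y hy.1 hxy.le).and self_mem_nhdsWithin).exists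
  have hpos : 0 < ε := hpos
  refine ((mem_extremePoints.1 hx).2 y hy.1 _ hε ?_).1.symm
  refine ⟨ε / (1 + ε), 1 / (1 + ε), by positivity, by positivity, by field_simp; ring, ?_⟩
  match_scalars <;> field_simp <;> ring

end

end FaceLabeling

/-! ## Polyhedra given by affine inequalities -/

section Polyhedron

variable {E ι : Type*} [NormedAddCommGroup E] [NormedSpace ℝ E]

/-- The solutions of `h x = 0` and `0 ≤ g i x` for `i ∈ I`. -/
def polyhedron (h : E →ᵃ[ℝ] ℝ) (g : ι → E →ᵃ[ℝ] ℝ) (I : Finset ι) : Set E :=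
  {x | h x = 0 ∧ ∀ i ∈ I, 0 ≤ g i x}

open Classical in
/-- The inequalities from `I` that are equalities at `x`. -/
noncomputable def tightSet (g : ι → E →ᵃ[ℝ] ℝ) (I : Finset ι) (x : E) : Finset ι :=
  I.filter fun i => g i x = 0

variable {h : E →ᵃ[ℝ] ℝ} {g : ι → E →ᵃ[ℝ] ℝ} {I : Finset ι} {x y : E}

theorem mem_tightSet {i : ι} : i ∈ tightSet g I x ↔ i ∈ I ∧ g i x = 0 := by
  simp [tightSet]

theorem tightSet_subset : tightSet g I x ⊆ I := Finset.filter_subset _ _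

theorem convex_polyhedron : Convex ℝ (polyhedron h g I) := by
  intro x hx y hy a b ha hb hab
  refine ⟨?_, fun i hi => ?_⟩
  · rw [Convex.combo_affine_apply hab, hx.1, hy.1]
    simp
  · rw [Convex.combo_affine_apply hab]
    exact add_nonneg (mul_nonneg ha (hx.2 i hi)) (mul_nonneg hb (hy.2 i hi))

theorem mem_tightSet_combo (hx : x ∈ polyhedron h g I) (hy : y ∈ polyhedron h g I) {a b : ℝ}
    (ha : 0 < a) (hb : 0 < b) (hab : a + b = 1) {i : ι} :
    i ∈ tightSet g I (a • x + b • y) ↔ i ∈ tightSet g I x ∧ i ∈ tightSet g I y := by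
  simp only [mem_tightSet]
  constructor
  · rintro ⟨hi, h0⟩
    rw [Convex.combo_affine_apply hab] at h0
    have h1 := mul_nonneg ha.le (hx.2 i hi)
    have h2 := mul_nonneg hb.le (hy.2 i hi)
    simp only [smul_eq_mul] at h0
    have h3 : a * g i x = 0 := by linarith
    have h4 : b * g i y = 0 := by linarith
    exact ⟨⟨hi, (mul_eq_zero.1 h3).resolve_left ha.ne'⟩, hi,
      (mul_eq_zero.1 h4).resolve_left hb.ne'⟩
  · rintro ⟨⟨hi, h1⟩, -, h2⟩
    refine ⟨hi, ?_⟩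
    rw [Convex.combo_affine_apply hab, h1, h2]
    simp

theorem tightSet_combo_of_subset (hx : x ∈ polyhedron h g I) (hy : y ∈ polyhedron h g I)
    (hxy : tightSet g I x ⊆ tightSet g I y) {a b : ℝ}
    (ha : 0 < a) (hb : 0 < b) (hab : a + b = 1) :
    tightSet g I (a • x + b • y) = tightSet g I x := by
  ext i
  rw [mem_tightSet_combo hx hy ha hb hab]
  exact ⟨fun hi => hi.1, fun hi => ⟨hi, hxy hi⟩⟩

theorem AffineMap.apply_add_smul (f : E →ᵃ[ℝ] ℝ) (x d : E) (ε : ℝ) :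
    f (x + ε • d) = f x + ε * f.linear d := by
  rw [add_comm x, ← vadd_eq_add, AffineMap.map_vadd]
  simp [add_comm]

theorem eventually_add_smul_mem_polyhedron (hx : x ∈ polyhedron h g I) {d : E}
    (hd : h.linear d = 0) (hdi : ∀ i ∈ tightSet g I x, 0 ≤ (g i).linear d) :
    ∀ᶠ ε in nhdsWithin (0 : ℝ) (Set.Ioi 0), x + ε • d ∈ polyhedron h g I := by
  have key : ∀ i ∈ I, ∀ᶠ ε in nhdsWithin (0 : ℝ) (Set.Ioi 0), 0 ≤ g i (x + ε • d) := by
    intro i hi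
    by_cases h0 : g i x = 0
    · filter_upwards [self_mem_nhdsWithin] with ε hε
      have hε : 0 < ε := hε
      rw [AffineMap.apply_add_smul, h0, zero_add]
      exact mul_nonneg hε.le (hdi i (mem_tightSet.2 ⟨hi, h0⟩))
    · have hpos : 0 < g i x := lt_of_le_of_ne (hx.2 i hi) (Ne.symm h0)
      have hc : Filter.Tendsto (fun ε : ℝ => g i x + ε * (g i).linear d) (nhds 0)
          (nhds (g i x + 0 * (g i).linear d)) := by
        apply Continuous.tendsto
        fun_prop
      rw [zero_mul, add_zero] at hc
      filter_upwards [nhdsWithin_le_nhds (hc.eventually (lt_mem_nhds hpos))] with ε hε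
      rw [AffineMap.apply_add_smul]
      exact hε.le
  filter_upwards [(Filter.eventually_all_finset I).2 key] with ε hε
  exact ⟨by rw [AffineMap.apply_add_smul, hx.1, hd]; simp, hε⟩

variable [FiniteDimensional ℝ E]

theorem faceLabeling_polyhedron : FaceLabeling (polyhedron h g I) (tightSet g I) where
  convex := convex_polyhedron
  finite := (Finset.finite_toSet I.powerset).subset <| by
    rintro _ ⟨x, -, rfl⟩
    exact Finset.mem_coe.2 (Finset.mem_powerset.2 tightSet_subset)
  midpoint_le x hx y hy := by
    have e : midpoint ℝ x y = (1 / 2 : ℝ) • x + (1 / 2 : ℝ) • y := by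
      rw [midpoint_eq_smul_add, smul_add, invOf_eq_inv, one_div]
    rw [e]
    exact ⟨fun i hi => ((mem_tightSet_combo hx hy (by norm_num) (by norm_num) (by norm_num)).1 hi).1,
      fun i hi => ((mem_tightSet_combo hx hy (by norm_num) (by norm_num) (by norm_num)).1 hi).2⟩
  extend x hx y hy hxy := by
    have hlin : ∀ f : E →ᵃ[ℝ] ℝ, f.linear (x - y) = f x - f y := fun f => by
      rw [← vsub_eq_sub, AffineMap.linearMap_vsub, vsub_eq_sub]
    refine eventually_add_smul_mem_polyhedron hx ?_ fun i hi => ?_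
    · rw [hlin, hx.1, hy.1, sub_zero]
    · rw [hlin, (mem_tightSet.1 hi).2, (mem_tightSet.1 (hxy hi)).2, sub_zero]
  exposed x hx := by
    intro _
    -- The sum of the inequalities tight at `x` is nonnegative on the polyhedron and vanishes
    -- exactly where all of them are tight; its negative exposes the face.
    refine ⟨LinearMap.toContinuousLinearMap (-∑ i ∈ tightSet g I x, (g i).linear), ?_⟩
    have hl : ∀ y z : E, (-∑ i ∈ tightSet g I x, (g i).linear) y ≤
        (-∑ i ∈ tightSet g I x, (g i).linear) z ↔
        ∑ i ∈ tightSet g I x, g i z ≤ ∑ i ∈ tightSet g I x, g i y := by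
      intro y z
      rw [← sub_nonneg, ← map_sub, ← sub_nonneg (b := ∑ i ∈ tightSet g I x, g i z),
        ← Finset.sum_sub_distrib]
      simp only [LinearMap.neg_apply, LinearMap.sum_apply, ← Finset.sum_neg_distrib]
      refine iff_of_eq (congrArg _ (Finset.sum_congr rfl fun i _ => ?_))
      rw [← vsub_eq_sub z y, AffineMap.linearMap_vsub, vsub_eq_sub, neg_sub]
    ext y
    simp only [LinearMap.coe_toContinuousLinearMap', hl, Set.mem_ofPred_eq]
    refine and_congr_right fun hy => ?_
    have hxs : ∑ i ∈ tightSet g I x, g i x = 0 :=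
      Finset.sum_eq_zero fun i hi => (mem_tightSet.1 hi).2
    have hnonneg : ∀ z ∈ polyhedron h g I, ∀ i ∈ tightSet g I x, 0 ≤ g i z :=
      fun z hz i hi => hz.2 i (tightSet_subset hi)
    constructor
    · intro hxy z hz
      rw [Finset.sum_eq_zero fun i hi => (mem_tightSet.1 (hxy hi)).2]
      exact Finset.sum_nonneg (hnonneg z hz)
    · intro hmax i hi
      have h0 := le_antisymm (hxs ▸ hmax x hx) (Finset.sum_nonneg (hnonneg y hy))
      exact mem_tightSet.2 ⟨tightSet_subset hi,
        (Finset.sum_eq_zero_iff_of_nonneg (hnonneg y hy)).1 h0 i hi⟩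

end Polyhedron

/-! ## Truncations -/

section Truncation

/-- The maximizers of `f` on `K` form a compact exposed subset, which has an extreme point by
Krein–Milman, and extremality is transitive. This carries sign conditions from the vertices of `P`
to its faces. -/
theorem IsExtreme.exists_extremePoint_le {E : Type*} [NormedAddCommGroup E] [NormedSpace ℝ E]
    [FiniteDimensional ℝ E] {P K : Set E}
    (hPK : IsExtreme ℝ P K) (hK : IsCompact K) (hne : K.Nonempty) (f : E →ᵃ[ℝ] ℝ) :
    ∃ w ∈ P.extremePoints ℝ, w ∈ K ∧ ∀ y ∈ K, f y ≤ f w := by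
  set l : StrongDual ℝ E := LinearMap.toContinuousLinearMap f.linear with hl
  have hexp : IsExposed ℝ K (l.toExposed K) := ContinuousLinearMap.toExposed.isExposed
  obtain ⟨z, hz, hzmax⟩ := hK.exists_isMaxOn hne l.continuous.continuousOn
  have hne' : (l.toExposed K).Nonempty := ⟨z, hz, fun y hy => hzmax hy⟩
  obtain ⟨w, hw⟩ := (hexp.isCompact hK).extremePoints_nonempty hne'
  refine ⟨w, hPK.extremePoints_subset_extremePoints
    (hexp.isExtreme.extremePoints_subset_extremePoints hw), hw.1.1, fun y hy => ?_⟩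
  have h1 : f.linear y ≤ f.linear w := hw.1.2 y hy
  have h2 : f.linear (y - w) = f y - f w := by
    rw [← vsub_eq_sub, AffineMap.linearMap_vsub, vsub_eq_sub]
  rw [map_sub] at h2
  linarith

variable {E ι : Type*} [NormedAddCommGroup E] [NormedSpace ℝ E]
  {h : E →ᵃ[ℝ] ℝ} {g : ι → E →ᵃ[ℝ] ℝ} {I : Finset ι}

/-- The points of a polyhedron with prescribed tight inequalities form an extreme set. -/
theorem isExtreme_tightSet (S : Finset ι) :
    IsExtreme ℝ (polyhedron h g I) {x | x ∈ polyhedron h g I ∧ S ⊆ tightSet g I x} := by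
  refine ⟨fun x hx => hx.1, ?_⟩
  rintro x hx y hy _ ⟨hz, hS⟩ ⟨a, b, ha, hb, hab, rfl⟩
  exact ⟨hx, fun i hi => ((mem_tightSet_combo hx hy ha hb hab).1 (hS hi)).1⟩

variable [FiniteDimensional ℝ E]

theorem isClosed_polyhedron : IsClosed (polyhedron h g I) := by
  have hc : ∀ f : E →ᵃ[ℝ] ℝ, Continuous f := fun f => f.continuous_of_finiteDimensional
  have e : polyhedron h g I = {x | h x = 0} ∩ ⋂ i ∈ I, {x | 0 ≤ g i x} := by
    ext x
    simp [polyhedron]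
  rw [e]
  exact (isClosed_eq (hc h) continuous_const).inter
    (isClosed_biInter fun i _ => isClosed_le continuous_const (hc _))

theorem isCompact_tightSet (hP : IsCompact (polyhedron h g I)) (S : Finset ι) (hS : S ⊆ I) :
    IsCompact {x | x ∈ polyhedron h g I ∧ S ⊆ tightSet g I x} := by
  have hc : ∀ f : E →ᵃ[ℝ] ℝ, Continuous f := fun f => f.continuous_of_finiteDimensional
  have e : {x | x ∈ polyhedron h g I ∧ S ⊆ tightSet g I x} =
      polyhedron h g I ∩ ⋂ i ∈ S, {x | g i x = 0} := by
    ext x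
    simp only [Set.mem_ofPred_eq, Set.mem_inter_iff, Set.mem_iInter]
    exact and_congr_right fun _ => ⟨fun H i hi => (mem_tightSet.1 (H hi)).2,
      fun H i hi => mem_tightSet.2 ⟨hS hi, H i hi⟩⟩
  rw [e]
  exact hP.inter_right (isClosed_biInter fun i _ => isClosed_eq (hc _) continuous_const)

variable [DecidableEq ι]

/-- The sets of tight inequalities after a truncation, which are obtained from those before it by
a stellar subdivision. -/
theorem exists_tightSet_insert_eq_iff (hP : IsCompact (polyhedron h g I)) {τ : Finset ι}
    (hτ : τ ⊆ I) {t : ι} (ht : t ∉ I)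
    (htr : ∀ x ∈ (polyhedron h g I).extremePoints ℝ,
      (τ ⊆ tightSet g I x → g t x < 0) ∧ (¬ τ ⊆ tightSet g I x → 0 < g t x))
    (S : Finset ι) :
    (∃ x ∈ polyhedron h g (insert t I), tightSet g (insert t I) x = S) ↔
      ¬ τ ⊆ S.erase t ∧ (∃ x ∈ polyhedron h g I, tightSet g I x = S.erase t) ∧
        (t ∈ S → ∃ x ∈ polyhedron h g I, S.erase t ∪ τ ⊆ tightSet g I x) := by
  have hmem : ∀ x, x ∈ polyhedron h g (insert t I) ↔ x ∈ polyhedron h g I ∧ 0 ≤ g t x := by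
    intro x
    simp only [polyhedron, Set.mem_ofPred_eq, Finset.forall_mem_insert]
    tauto
  have htight : ∀ x, (tightSet g (insert t I) x).erase t = tightSet g I x := by
    intro x
    ext i
    simp only [Finset.mem_erase, mem_tightSet, Finset.mem_insert]
    constructor
    · rintro ⟨h1, h2 | h2, h3⟩
      · exact absurd h2 h1
      · exact ⟨h2, h3⟩
    · rintro ⟨h1, h2⟩
      exact ⟨fun h3 => ht (h3 ▸ h1), Or.inr h1, h2⟩
  have htmem : ∀ x, t ∈ tightSet g (insert t I) x ↔ g t x = 0 := by
    intro x
    simp [mem_tightSet]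
  have heq : ∀ x, tightSet g (insert t I) x = S ↔
      tightSet g I x = S.erase t ∧ (g t x = 0 ↔ t ∈ S) := by
    intro x
    rw [← htight, ← htmem]
    constructor
    · rintro rfl
      exact ⟨rfl, Iff.rfl⟩
    · rintro ⟨h1, h2⟩
      ext i
      by_cases hi : i = t
      · rw [hi, h2]
      · have := Finset.ext_iff.1 h1 i
        simpa [hi] using this
  have hneg : ∀ x ∈ polyhedron h g I, τ ⊆ tightSet g I x → g t x < 0 := by
    intro x hx hxτ
    obtain ⟨w, hw, hwF, hle⟩ := (isExtreme_tightSet τ).exists_extremePoint_le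
      (isCompact_tightSet hP τ hτ) ⟨x, hx, hxτ⟩ (g t)
    exact (hle x ⟨hx, hxτ⟩).trans_lt ((htr w hw).1 hwF.2)
  constructor
  · rintro ⟨x, hx, hxS⟩
    rw [hmem] at hx
    obtain ⟨h1, h2⟩ := (heq x).1 hxS
    refine ⟨fun hτS => ?_, ⟨x, hx.1, h1⟩, fun htS => ?_⟩
    · exact absurd (hneg x hx.1 (h1 ▸ hτS)) (not_lt.2 hx.2)
    · have h0 := h2.2 htS
      -- The face of `x` has a vertex where `g t` is at most `g t x = 0`; such a vertex is not kept
      -- by the truncation, so it lies on the truncated face.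
      obtain ⟨w, hw, hwF, hle⟩ := (isExtreme_tightSet (tightSet g I x)).exists_extremePoint_le
        (isCompact_tightSet hP _ tightSet_subset) ⟨x, hx.1, subset_rfl⟩ (-g t)
      refine ⟨w, hwF.1, Finset.union_subset (h1 ▸ hwF.2) ?_⟩
      by_contra hcon
      have h3 := (htr w hw).2 hcon
      have h4 := hle x ⟨hx.1, subset_rfl⟩
      have h5 : -(g t x) ≤ -(g t w) := h4
      linarith
  · rintro ⟨h1, ⟨x, hx, hxS⟩, h2⟩
    -- a point with the same tight inequalities on the positive side
    obtain ⟨y, hy, hyS, hypos⟩ : ∃ y ∈ polyhedron h g I, tightSet g I y = S.erase t ∧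
        0 < g t y := by
      by_cases hxpos : 0 < g t x
      · exact ⟨x, hx, hxS, hxpos⟩
      -- Some `i ∈ τ` is not tight at `x`; maximizing `g i` over the face of `x` gives a vertex
      -- where it is still positive. Moving from `x` towards this vertex keeps the label and reaches
      -- the positive side.
      obtain ⟨w, hw, hwτ, hwS⟩ : ∃ w ∈ (polyhedron h g I).extremePoints ℝ,
          ¬ τ ⊆ tightSet g I w ∧ tightSet g I x ⊆ tightSet g I w := by
        obtain ⟨i, hiτ, hiS⟩ := Finset.not_subset.1 h1
        obtain ⟨w, hw, hwF, hle⟩ := (isExtreme_tightSet (tightSet g I x)).exists_extremePoint_le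
          (isCompact_tightSet hP _ tightSet_subset) ⟨x, hx, subset_rfl⟩ (g i)
        refine ⟨w, hw, fun hsub => ?_, hwF.2⟩
        have h3 := (mem_tightSet.1 (hsub hiτ)).2
        have h4 := hle x ⟨hx, subset_rfl⟩
        refine hiS (hxS ▸ mem_tightSet.2 ⟨hτ hiτ, le_antisymm (h3 ▸ h4) (hx.2 i (hτ hiτ))⟩)
      have hwpos := (htr w hw).2 hwτ
      have hd : 0 < g t w - g t x := by linarith
      obtain ⟨a, b, ha, hb, hab, hpos⟩ : ∃ a b : ℝ, 0 < a ∧ 0 < b ∧ a + b = 1 ∧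
          0 < a * g t x + b * g t w := by
        -- The weights make the value of `g t` equal to `g t w / 2`.
        refine ⟨g t w / (2 * (g t w - g t x)), (g t w - 2 * g t x) / (2 * (g t w - g t x)),
          div_pos (by linarith) (by linarith), div_pos (by linarith) (by linarith), ?_, ?_⟩
        · field_simp
          ring
        · have e : g t w / (2 * (g t w - g t x)) * g t x +
              (g t w - 2 * g t x) / (2 * (g t w - g t x)) * g t w = g t w / 2 := by
            field_simp
            ring
          rw [e]
          linarith
      refine ⟨_, convex_polyhedron hx hw.1 ha.le hb.le hab,
        (tightSet_combo_of_subset hx hw.1 hwS ha hb hab).trans hxS, ?_⟩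
      rw [Convex.combo_affine_apply hab]
      exact hpos
    by_cases htS : t ∈ S
    · obtain ⟨z, hz, hzS⟩ := h2 htS
      have hzneg := hneg z hz (Finset.union_subset_right hzS)
      have hyz : tightSet g I y ⊆ tightSet g I z := hyS ▸ Finset.union_subset_left hzS
      have hd : 0 < g t y - g t z := by linarith
      have ha : 0 < -g t z / (g t y - g t z) := div_pos (by linarith) hd
      have hb : 0 < g t y / (g t y - g t z) := div_pos hypos hd
      have hab : -g t z / (g t y - g t z) + g t y / (g t y - g t z) = 1 := by
        field_simp
        ring
      have e : g t ((-g t z / (g t y - g t z)) • y + (g t y / (g t y - g t z)) • z) = 0 := by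
        rw [Convex.combo_affine_apply hab]
        simp only [smul_eq_mul]
        field_simp
        ring
      exact ⟨_, (hmem _).2 ⟨convex_polyhedron hy hz ha.le hb.le hab, e.ge⟩,
        (heq _).2 ⟨(tightSet_combo_of_subset hy hz hyz ha hb hab).trans hyS,
          iff_of_true e htS⟩⟩
    · exact ⟨y, (hmem y).2 ⟨hy, hypos.le⟩, (heq y).2 ⟨hyS, iff_of_false hypos.ne' htS⟩⟩

end Truncation

/-! ## Nested sets -/

section Nested

variable {V : Type*} [DecidableEq V]

/-- The union of a family of nodes and of sets of nodes. -/
def nodeSupport (S : Finset (V ⊕ Finset V)) : Finset V :=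
  S.biUnion (Sum.elim singleton id)

theorem mem_nodeSupport {S : Finset (V ⊕ Finset V)} {v : V} :
    v ∈ nodeSupport S ↔ Sum.inl v ∈ S ∨ ∃ s, Sum.inr s ∈ S ∧ v ∈ s := by
  simp [nodeSupport]

theorem subset_nodeSupport {S : Finset (V ⊕ Finset V)} {s : Finset V} (hs : Sum.inr s ∈ S) :
    s ⊆ nodeSupport S := fun _ hv => mem_nodeSupport.2 (Or.inr ⟨s, hs, hv⟩)

variable [Fintype V]

/-- The nested sets formed by nodes and members of `B`: a subfamily whose union is in `B` or
contains all nodes has its union as a member. -/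
def IsNestedFamily (B : Finset (Finset V)) (S : Finset (V ⊕ Finset V)) : Prop :=
  S ⊆ Finset.univ.disjSum B ∧ ∀ S' ⊆ S, nodeSupport S' ∈ B ∨ nodeSupport S' = Finset.univ →
    Sum.inr (nodeSupport S') ∈ S'

/-- Adjoining to `B` a set not larger than its members results in a stellar subdivision. -/
theorem isNestedFamily_insert_iff {B : Finset (Finset V)} {t : Finset V} (ht : t ∉ B)
    (htu : t ≠ Finset.univ) (hcard : ∀ s ∈ B, t.card ≤ s.card)
    (hunion : ∀ s ∈ B, (s ∩ t).Nonempty → s ∪ t ∈ B ∨ s ∪ t = Finset.univ ∨ s ∪ t = t)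
    (S : Finset (V ⊕ Finset V)) :
    IsNestedFamily (insert t B) S ↔
      ¬ t.map Function.Embedding.inl ⊆ S.erase (Sum.inr t) ∧
        IsNestedFamily B (S.erase (Sum.inr t)) ∧
        (Sum.inr t ∈ S →
          ∃ S₂, IsNestedFamily B S₂ ∧ S.erase (Sum.inr t) ∪ t.map Function.Embedding.inl ⊆ S₂) := by
  -- This is where the order of truncation enters: as `t` is not larger than the members of `B`,
  -- none of them lies inside `t`.
  have hnot : ∀ s ∈ B, ¬ s ⊆ t := fun s hs hst =>
    ht (Finset.eq_of_subset_of_card_le hst (hcard s hs) ▸ hs)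
  have hsub : S ⊆ Finset.univ.disjSum (insert t B) ↔
      S.erase (Sum.inr t) ⊆ Finset.univ.disjSum B := by
    constructor
    · intro h i hi
      have := h (Finset.mem_of_mem_erase hi)
      rcases i with v | s
      · simp
      · simp only [Finset.inr_mem_disjSum, Finset.mem_insert] at this ⊢
        exact this.resolve_left fun e => Finset.ne_of_mem_erase hi (e ▸ rfl)
    · intro h i hi
      rcases i with v | s
      · simp
      · by_cases hs : s = t
        · simp [hs]
        · have := h (Finset.mem_erase.2 ⟨by simpa using hs, hi⟩)
          simp only [Finset.inr_mem_disjSum, Finset.mem_insert] at this ⊢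
          exact Or.inr this
  constructor
  · rintro ⟨h1, h2⟩
    have h0 : IsNestedFamily B (S.erase (Sum.inr t)) := by
      refine ⟨hsub.1 h1, fun S' hS' hu => h2 S' (hS'.trans (Finset.erase_subset _ _)) ?_⟩
      exact hu.imp_left Finset.mem_insert_of_mem
    refine ⟨fun hτ => ?_, h0, fun htS => ⟨_, ⟨?_, fun S' hS' hu => ?_⟩, subset_rfl⟩⟩
    · have e : nodeSupport (t.map Function.Embedding.inl) = t := by
        ext v
        simp [mem_nodeSupport]
      have := h2 _ (hτ.trans (Finset.erase_subset _ _))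
        (Or.inl (e.symm ▸ Finset.mem_insert_self _ _))
      simp at this
    · refine Finset.union_subset h0.1 fun i hi => ?_
      obtain ⟨v, -, rfl⟩ := Finset.mem_map.1 hi
      simp
    · by_cases hS0 : S' ⊆ S.erase (Sum.inr t)
      · exact h0.2 S' hS0 hu
      obtain ⟨i, hi, hi0⟩ := Finset.not_subset.1 hS0
      obtain ⟨v, hv, rfl⟩ := Finset.mem_map.1 ((Finset.mem_union.1 (hS' hi)).resolve_left hi0)
      have hvS : v ∈ nodeSupport S' := mem_nodeSupport.2 (Or.inl hi)
      -- Trading the adjoined nodes of `t` for the member `t` gives a subfamily of `S`. Its union is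
      -- again in `B` or full, hence belongs to it, which forces `t ⊆ nodeSupport S'`.
      have e : nodeSupport (insert (Sum.inr t) (S' ∩ S)) = nodeSupport S' ∪ t := by
        ext w
        simp only [mem_nodeSupport, Finset.mem_insert, Finset.mem_inter, Finset.mem_union]
        constructor
        · rintro (h | ⟨s, h | h, hw⟩)
          · exact Or.inl (Or.inl (h.resolve_left (by simp)).1)
          · exact Or.inr (Sum.inr_injective h ▸ hw)
          · exact Or.inl (Or.inr ⟨s, h.1, hw⟩)
        · rintro ((h | ⟨s, h, hw⟩) | hw)
          · rcases Finset.mem_union.1 (hS' h) with h' | h'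
            · exact Or.inl (Or.inr ⟨h, Finset.mem_of_mem_erase h'⟩)
            · exact Or.inr ⟨t, Or.inl rfl, by simpa using h'⟩
          · rcases Finset.mem_union.1 (hS' h) with h' | h'
            · exact Or.inr ⟨s, Or.inr ⟨h, Finset.mem_of_mem_erase h'⟩, hw⟩
            · simp at h'
          · exact Or.inr ⟨t, Or.inl rfl, hw⟩
      have hne : nodeSupport S' ∪ t ≠ t := by
        intro h
        rw [Finset.union_eq_right] at h
        rcases hu with hu | hu
        · exact hnot _ hu h
        · exact htu (Finset.univ_subset_iff.1 (hu ▸ h))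
      have hmem : nodeSupport S' ∪ t ∈ B ∨ nodeSupport S' ∪ t = Finset.univ := by
        rcases hu with hu | hu
        · have := hunion _ hu ⟨v, Finset.mem_inter.2 ⟨hvS, hv⟩⟩
          tauto
        · exact Or.inr (by rw [hu, Finset.union_eq_left.2 (Finset.subset_univ _)])
      have h3 := h2 (insert (Sum.inr t) (S' ∩ S))
        (Finset.insert_subset htS Finset.inter_subset_right)
        (by rw [e]; exact hmem.imp_left Finset.mem_insert_of_mem)
      rw [e] at h3
      have h4 : Sum.inr (nodeSupport S' ∪ t) ∈ S' :=
        (Finset.mem_inter.1 ((Finset.mem_insert.1 h3).resolve_left (by simpa using hne))).1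
      have h5 : nodeSupport S' ∪ t = nodeSupport S' :=
        (subset_nodeSupport h4).antisymm Finset.subset_union_left
      rwa [h5] at h4
  · rintro ⟨h1, h2, h3⟩
    refine ⟨hsub.2 h2.1, fun S' hS' hu => ?_⟩
    by_cases htS' : Sum.inr t ∈ S'
    · by_cases hut : nodeSupport S' = t
      · rwa [hut]
      obtain ⟨S₂, hS₂, hsub₂⟩ := h3 (hS' htS')
      have hu' : nodeSupport S' ∈ B ∨ nodeSupport S' = Finset.univ :=
        hu.imp_left fun h => (Finset.mem_insert.1 h).resolve_left hut
      -- The reverse trade: the member `t` is replaced by its nodes, which gives a subfamily of `S₂`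
      -- with the same union.
      have e : nodeSupport (S'.erase (Sum.inr t) ∪ t.map Function.Embedding.inl) =
          nodeSupport S' := by
        ext w
        simp only [mem_nodeSupport, Finset.mem_union, Finset.mem_erase, Finset.mem_map]
        constructor
        · rintro ((h | ⟨v, hv, h⟩) | ⟨s, h | ⟨v, hv, h⟩, hw⟩)
          · exact Or.inl h.2
          · exact Or.inr ⟨t, htS', Sum.inl_injective h ▸ hv⟩
          · exact Or.inr ⟨s, h.2, hw⟩
          · exact absurd h (by simp)
        · rintro (h | ⟨s, h, hw⟩)
          · exact Or.inl (Or.inl ⟨by simp, h⟩)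
          · by_cases hs : s = t
            · exact Or.inl (Or.inr ⟨w, hs ▸ hw, rfl⟩)
            · exact Or.inr ⟨s, Or.inl ⟨by simpa using hs, h⟩, hw⟩
      have h4 := hS₂.2 _ ((Finset.union_subset_union_left (Finset.erase_subset_erase _ hS')).trans
        hsub₂) (by rwa [e])
      rw [e] at h4
      rcases Finset.mem_union.1 h4 with h | h
      · exact Finset.mem_of_mem_erase h
      · simp at h
    · have hS0 : S' ⊆ S.erase (Sum.inr t) := fun i hi =>
        Finset.mem_erase.2 ⟨fun h => htS' (h ▸ hi), hS' hi⟩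
      by_cases hut : nodeSupport S' = t
      -- No member of `B` lies in `t`, so a subfamily with union `t` that avoids the member `t`
      -- contains every node of `t`.
      · refine absurd (fun i hi => hS0 ?_) h1
        obtain ⟨v, hv, rfl⟩ := Finset.mem_map.1 hi
        rcases mem_nodeSupport.1 (hut.symm ▸ hv : v ∈ nodeSupport S') with h | ⟨s, h, -⟩
        · exact h
        · exact absurd (hut ▸ subset_nodeSupport h)
            (hnot s (Finset.inr_mem_disjSum.1 (h2.1 (hS0 h))))
      · exact h2.2 S' hS0 (hu.imp_left fun h => (Finset.mem_insert.1 h).resolve_left hut)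

end Nested

/-! ## The tight constraints at the points of a graph-associahedron -/

theorem SimpleGraph.induce_finset_union_connected {V : Type*} [DecidableEq V] {G : SimpleGraph V}
    {s t : Finset V}
    (hs : (G.induce {v | v ∈ s}).Connected) (ht : (G.induce {v | v ∈ t}).Connected)
    (hst : (s ∩ t).Nonempty) : (G.induce {v | v ∈ s ∪ t}).Connected := by
  have e : {v | v ∈ s ∪ t} = {v | v ∈ s} ∪ {v | v ∈ t} := by
    ext v
    simp
  rw [e]
  refine SimpleGraph.induce_union_connected hs.preconnected ht.preconnected ?_
  obtain ⟨v, hv⟩ := hst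
  exact ⟨v, (Finset.mem_inter.1 hv).1, (Finset.mem_inter.1 hv).2⟩

section CutSimplex

variable {V : Type*}

/-- The inequalities of a cut simplex: one for each node and one for each set of nodes. -/
noncomputable def cutConstraint (normal : Finset V → ((V → ℝ) →ₗ[ℝ] ℝ)) (level : Finset V → ℝ) :
    V ⊕ Finset V → (V → ℝ) →ᵃ[ℝ] ℝ :=
  Sum.elim (fun v => (LinearMap.proj v : (V → ℝ) →ₗ[ℝ] ℝ).toAffineMap)
    fun t => (normal t).toAffineMap - AffineMap.const ℝ _ (level t)

variable {normal : Finset V → ((V → ℝ) →ₗ[ℝ] ℝ)} {level : Finset V → ℝ}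

theorem cutConstraint_inl (v : V) (x : V → ℝ) :
    cutConstraint normal level (Sum.inl v) x = x v := by
  simp [cutConstraint]

theorem cutConstraint_inr (t : Finset V) (x : V → ℝ) :
    cutConstraint normal level (Sum.inr t) x = normal t x - level t := by
  simp [cutConstraint]

variable [Fintype V]

/-- The affine functional vanishing on the hyperplane of the standard simplex. -/
noncomputable def simplexEquation : (V → ℝ) →ᵃ[ℝ] ℝ :=
  (∑ v, LinearMap.proj v : (V → ℝ) →ₗ[ℝ] ℝ).toAffineMap - AffineMap.const ℝ _ 1

theorem simplexEquation_apply (x : V → ℝ) : simplexEquation x = ∑ v, x v - 1 := by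
  simp [simplexEquation]

variable [DecidableEq V]

theorem cutSimplex_eq_polyhedron (L : List (Finset V)) :
    cutSimplex normal level L = polyhedron simplexEquation (cutConstraint normal level)
      (Finset.univ.disjSum L.toFinset) := by
  ext x
  simp only [cutSimplex, polyhedron, Set.mem_ofPred_eq, stdSimplex, simplexEquation_apply,
    sub_eq_zero]
  constructor
  · rintro ⟨⟨h1, h2⟩, h3⟩
    refine ⟨h2, ?_⟩
    rintro (v | t) hi
    · rw [cutConstraint_inl]
      exact h1 v
    · rw [cutConstraint_inr, sub_nonneg]
      exact h3 t (by simpa using hi)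
  · rintro ⟨h1, h2⟩
    refine ⟨⟨fun v => ?_, h1⟩, fun t ht => ?_⟩
    · simpa only [cutConstraint_inl] using h2 (Sum.inl v) (by simp)
    · simpa only [cutConstraint_inr, sub_nonneg] using h2 (Sum.inr t) (by simpa using ht)

theorem isCompact_cutSimplex (L : List (Finset V)) : IsCompact (cutSimplex normal level L) := by
  refine (isCompact_stdSimplex ℝ V).of_isClosed_subset ?_ fun x hx => hx.1
  rw [cutSimplex_eq_polyhedron]
  exact isClosed_polyhedron

/-- The inequalities of a cut simplex that are tight at a point. -/
noncomputable abbrev cutTight (normal : Finset V → ((V → ℝ) →ₗ[ℝ] ℝ)) (level : Finset V → ℝ)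
    (L : List (Finset V)) (x : V → ℝ) : Finset (V ⊕ Finset V) :=
  tightSet (cutConstraint normal level) (Finset.univ.disjSum L.toFinset) x

theorem inl_mem_cutTight {L : List (Finset V)} {x : V → ℝ} {v : V} :
    Sum.inl v ∈ cutTight normal level L x ↔ x v = 0 := by
  simp [mem_tightSet, cutConstraint_inl]

theorem inr_mem_cutTight {L : List (Finset V)} {x : V → ℝ} {t : Finset V} :
    Sum.inr t ∈ cutTight normal level L x ↔ t ∈ L ∧ normal t x = level t := by
  simp [mem_tightSet, cutConstraint_inr, sub_eq_zero]

theorem mem_inter_simplexFace_iff {L : List (Finset V)} {x : V → ℝ} {t : Finset V}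
    (hx : x ∈ cutSimplex normal level L) :
    x ∈ cutSimplex normal level L ∩ simplexFace t ↔
      t.map Function.Embedding.inl ⊆ cutTight normal level L x := by
  constructor
  · rintro ⟨-, -, h⟩ i hi
    obtain ⟨v, hv, rfl⟩ := Finset.mem_map.1 hi
    exact inl_mem_cutTight.2 (h v hv)
  · intro h
    exact ⟨hx, hx.1, fun v hv => inl_mem_cutTight.1 (h (Finset.mem_map_of_mem _ hv))⟩

theorem exists_cutTight_nil_iff (S : Finset (V ⊕ Finset V)) :
    (∃ x ∈ cutSimplex normal level [], cutTight normal level [] x = S) ↔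
      IsNestedFamily ∅ S := by
  constructor
  · rintro ⟨x, hx, rfl⟩
    refine ⟨tightSet_subset, fun S' hS' hu => ?_⟩
    exfalso
    have hu := hu.resolve_left (Finset.notMem_empty _)
    have h0 : ∀ v, x v = 0 := by
      intro v
      rcases mem_nodeSupport.1 (hu ▸ Finset.mem_univ v) with h | ⟨s, h, -⟩
      · exact inl_mem_cutTight.1 (hS' h)
      · simpa using (inr_mem_cutTight.1 (hS' h)).1
    have := hx.1.2
    simp [h0] at this
  · rintro ⟨h1, h2⟩
    obtain ⟨w, hw⟩ : ∃ w, Sum.inl w ∉ S := by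
      by_contra! hcon
      have := h2 S subset_rfl
        (Or.inr (Finset.eq_univ_of_forall fun v => mem_nodeSupport.2 (Or.inl (hcon v))))
      simpa using h1 this
    -- After normalization this is the barycentre of the face on which the coordinates in `S`
    -- vanish.
    set y : V → ℝ := fun v => if Sum.inl v ∈ S then 0 else 1 with hy
    have hy0 : ∀ v, 0 ≤ y v := fun v => by
      simp only [hy]
      split_ifs <;> norm_num
    have hpos : 0 < ∑ v, y v :=
      Finset.sum_pos' (fun v _ => hy0 v) ⟨w, Finset.mem_univ _, by simp [hy, hw]⟩
    refine ⟨fun v => y v / ∑ v, y v, ⟨⟨fun v => div_nonneg (hy0 v) hpos.le, ?_⟩, by simp⟩, ?_⟩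
    · rw [← Finset.sum_div, div_self hpos.ne']
    · ext (v | t)
      · rw [inl_mem_cutTight, div_eq_zero_iff, or_iff_left hpos.ne']
        by_cases hv : Sum.inl v ∈ S <;> simp [hy, hv]
      · rw [inr_mem_cutTight]
        simp only [List.not_mem_nil, false_and, false_iff]
        intro h
        simpa using h1 h

end CutSimplex

namespace GraphAssociahedron

variable {V : Type*} [Fintype V] [DecidableEq V] {G : SimpleGraph V} (D : GraphAssociahedron G)

/-- Induction along the truncations: the geometric and the combinatorial stellar subdivision have
matching descriptions. -/
theorem exists_cutTight_iff {L₁ L₂ : List (Finset V)} (hL : D.order = L₁ ++ L₂)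
    (S : Finset (V ⊕ Finset V)) :
    (∃ x ∈ cutSimplex D.normal D.level L₁, cutTight D.normal D.level L₁ x = S) ↔
      IsNestedFamily L₁.toFinset S := by
  induction L₁ using List.reverseRecOn generalizing L₂ S with
  | nil => exact exists_cutTight_nil_iff S
  | append_singleton L t ih =>
    have hL' : D.order = L ++ t :: L₂ := by simpa using hL
    have hnodup := D.nodup
    have hsorted := D.sorted
    rw [hL'] at hnodup hsorted
    have htL : t ∉ L := fun h => (List.disjoint_of_nodup_append hnodup) h (by simp)
    have htube : IsTube G t := (D.mem_order t).1 (by simp [hL'])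
    have hcard : ∀ s ∈ L, t.card ≤ s.card := fun s hs =>
      (List.pairwise_append.1 hsorted).2.2 s hs t (by simp)
    have hins : (Finset.univ : Finset V).disjSum (L ++ [t]).toFinset =
        insert (Sum.inr t) (Finset.univ.disjSum L.toFinset) := by
      ext (v | s) <;> simp
    have hB : (L ++ [t]).toFinset = insert t L.toFinset := by
      ext s
      simp
    have hcompact : IsCompact (cutSimplex D.normal D.level L) := isCompact_cutSimplex L
    have htr := D.truncates L t L₂ hL'
    rw [hB, isNestedFamily_insert_iff (by simpa using htL) htube.2.1 (by simpa using hcard)]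
    · rw [← ih hL']
      simp only [← ih hL']
      simp only [cutTight, cutSimplex_eq_polyhedron, hins] at hcompact ⊢
      rw [exists_tightSet_insert_eq_iff hcompact (τ := t.map Function.Embedding.inl)]
      · refine and_congr_right fun _ => and_congr_right fun _ => imp_congr_right fun _ => ?_
        constructor
        · rintro ⟨x, hx, h⟩
          exact ⟨_, ⟨x, hx, rfl⟩, h⟩
        · rintro ⟨_, ⟨x, hx, rfl⟩, h⟩
          exact ⟨x, hx, h⟩
      · intro i hi
        obtain ⟨v, -, rfl⟩ := Finset.mem_map.1 hi
        simp
      · simpa using htL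
      · intro x hx
        rw [← cutSimplex_eq_polyhedron] at hx
        have h := htr x hx
        rw [mem_inter_simplexFace_iff hx.1] at h
        simpa only [cutConstraint_inr, sub_neg, sub_pos] using h
    · intro s hs hst
      have hs : s ∈ L := by simpa using hs
      have hstube : IsTube G s := (D.mem_order s).1 (by simp [hL', hs])
      by_cases hu : s ∪ t = Finset.univ
      · exact Or.inr (Or.inl hu)
      have hunion : IsTube G (s ∪ t) := ⟨hstube.1.mono Finset.subset_union_left, hu,
        SimpleGraph.induce_finset_union_connected hstube.2.2 htube.2.2 hst⟩
      have hmem := (D.mem_order _).2 hunion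
      rw [hL', List.mem_append, List.mem_cons] at hmem
      -- The tube `s ∪ t` cannot be listed strictly after `t`, as it would be no larger than `t` and
      -- hence equal to it.
      rcases hmem with h | h | h
      · exact Or.inl (by simpa using h)
      · exact Or.inr (Or.inr h)
      · have h1 := (List.pairwise_cons.1 (List.pairwise_append.1 hsorted).2.1).1 _ h
        exact Or.inr (Or.inr
          (Finset.eq_of_subset_of_card_le Finset.subset_union_right h1).symm)

end GraphAssociahedron

/-! ## The face poset of a graph-associahedron -/

section NestedTubing

variable {V : Type*}

theorem nodeSupport_map_inr [DecidableEq V] (T : Finset (Finset V)) :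
    nodeSupport (T.map Function.Embedding.inr) = T.sup id := by
  ext v
  simp [mem_nodeSupport, Finset.mem_sup]

variable [Fintype V]

/-- A set of tubes such that no union of some of its members is the set of all nodes, or a tube
that is not one of those members. -/
def IsNestedTubing (G : SimpleGraph V) [DecidableEq V] (T : Finset (Finset V)) : Prop :=
  (∀ s ∈ T, IsTube G s) ∧
    ∀ T' ⊆ T, IsTube G (T'.sup id) ∨ T'.sup id = Finset.univ → T'.sup id ∈ T'

variable [DecidableEq V]

theorem IsTube.isNestedTubing_singleton {G : SimpleGraph V} {t : Finset V} (ht : IsTube G t) :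
    IsNestedTubing G {t} := by
  refine ⟨by simpa using ht, fun T' hT' hu => ?_⟩
  rcases Finset.subset_singleton_iff.1 hT' with rfl | rfl
  · rcases hu with hu | hu
    · exact absurd hu.1 (by simp)
    · obtain ⟨v, -⟩ := ht.1
      have := hu.symm ▸ Finset.mem_univ v
      simp at this
  · simp

theorem isTube_singleton_or_eq_univ (G : SimpleGraph V) (v : V) :
    IsTube G {v} ∨ ({v} : Finset V) = Finset.univ := by
  by_cases h : ({v} : Finset V) = Finset.univ
  · exact Or.inr h
  · refine Or.inl ⟨by simp, h, ?_⟩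
    rw [SimpleGraph.connected_iff_exists_forall_reachable]
    refine ⟨⟨v, by simp⟩, ?_⟩
    rintro ⟨w, hw⟩
    obtain rfl : w = v := by simpa using hw
    exact SimpleGraph.Reachable.refl _

/-- Every singleton is a tube or the whole node set, so a nested family cannot contain a bare node:
the facets of the original simplex have been cut off entirely. -/
theorem isNestedFamily_iff {G : SimpleGraph V} {B : Finset (Finset V)}
    (hB : ∀ t, t ∈ B ↔ IsTube G t) (S : Finset (V ⊕ Finset V)) :
    IsNestedFamily B S ↔ ∃ T, IsNestedTubing G T ∧ T.map Function.Embedding.inr = S := by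
  constructor
  · rintro ⟨h1, h2⟩
    have h3 : ∀ v, Sum.inl v ∉ S := by
      intro v hv
      have e : nodeSupport {(Sum.inl v : V ⊕ Finset V)} = {v} := by
        ext w
        simp [mem_nodeSupport]
      have := h2 {Sum.inl v} (by simpa using hv)
        (by rw [e, hB]; exact isTube_singleton_or_eq_univ G v)
      simp at this
    have hS : S.toRight.map Function.Embedding.inr = S := by
      ext (v | s)
      · simpa using h3 v
      · simp
    refine ⟨S.toRight, ⟨fun s hs => ?_, fun T' hT' hu => ?_⟩, hS⟩
    · have := h1 (Finset.mem_toRight.1 hs)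
      simpa [hB] using this
    · have := h2 (T'.map Function.Embedding.inr)
        ((Finset.map_subset_map.2 hT').trans hS.subset)
        (by rwa [nodeSupport_map_inr, hB])
      simpa [nodeSupport_map_inr] using this
  · rintro ⟨T, ⟨h1, h2⟩, rfl⟩
    refine ⟨fun i hi => ?_, fun S' hS' hu => ?_⟩
    · obtain ⟨s, hs, rfl⟩ := Finset.mem_map.1 hi
      simpa [hB] using h1 s hs
    · obtain ⟨T', hT', rfl⟩ := Finset.subset_map_iff.1 hS'
      rw [nodeSupport_map_inr, hB] at hu
      simpa [nodeSupport_map_inr] using h2 T' hT' hu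

end NestedTubing

namespace GraphAssociahedron

variable {V : Type*} [Fintype V] [DecidableEq V] {G : SimpleGraph V} (D : GraphAssociahedron G)

open Classical in
/-- The tubes whose hyperplanes contain a point. -/
noncomputable def tightTubes (x : V → ℝ) : Finset (Finset V) :=
  D.order.toFinset.filter fun t => D.normal t x = D.level t

variable {D} in
theorem mem_tightTubes {x : V → ℝ} {t : Finset V} :
    t ∈ D.tightTubes x ↔ IsTube G t ∧ D.normal t x = D.level t := by
  simp [tightTubes, D.mem_order]

variable {D} in
theorem cutTight_eq {x : V → ℝ} (hx : x ∈ D.polytope) :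
    cutTight D.normal D.level D.order x = (D.tightTubes x).map Function.Embedding.inr := by
  obtain ⟨T, -, hT⟩ := (isNestedFamily_iff (G := G) (fun t => by simp [D.mem_order])
    (cutTight D.normal D.level D.order x)).1
    ((D.exists_cutTight_iff (List.append_nil _).symm _).1 ⟨x, hx, rfl⟩)
  ext (v | s)
  · rw [← hT]
    simp
  · rw [inr_mem_cutTight, D.mem_order, ← mem_tightTubes]
    simp

theorem image_tightTubes : D.tightTubes '' D.polytope = {T | IsNestedTubing G T} := by
  ext T
  have h1 := D.exists_cutTight_iff (List.append_nil _).symm (T.map Function.Embedding.inr)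
  rw [isNestedFamily_iff (G := G) (fun t => by simp [D.mem_order])] at h1
  simp only [Finset.map_inj, exists_eq_right] at h1
  rw [Set.mem_ofPred_eq, ← h1]
  constructor
  · rintro ⟨x, hx, rfl⟩
    exact ⟨x, hx, cutTight_eq hx⟩
  · rintro ⟨x, hx, hT⟩
    exact ⟨x, hx, Finset.map_injective _ ((cutTight_eq hx).symm.trans hT)⟩

theorem polytope_eq_polyhedron :
    D.polytope = polyhedron simplexEquation (cutConstraint D.normal D.level)
      (Finset.univ.disjSum D.order.toFinset) :=
  cutSimplex_eq_polyhedron D.order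

theorem faceLabeling : FaceLabeling D.polytope D.tightTubes := by
  have h : FaceLabeling D.polytope (cutTight D.normal D.level D.order) := by
    rw [polytope_eq_polyhedron]
    exact faceLabeling_polyhedron
  refine h.relabel (fun x hx y hy => ?_) ?_
  · rw [cutTight_eq hx, cutTight_eq hy]
    exact Finset.map_subset_map
  · refine (Finset.finite_toSet D.order.toFinset.powerset).subset ?_
    rintro _ ⟨x, -, rfl⟩
    exact Finset.mem_coe.2 (Finset.mem_powerset.2 (Finset.filter_subset _ _))

variable {D} in
theorem tubingFace_eq {T : Finset (Finset V)} (hT : ∀ t ∈ T, IsTube G t) :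
    D.tubingFace T = {x | x ∈ D.polytope ∧ T ≤ D.tightTubes x} := by
  ext x
  refine and_congr_right fun _ => forall₂_congr fun t ht => ?_
  exact ⟨fun h => mem_tightTubes.2 ⟨hT t ht, h⟩, fun h => (mem_tightTubes.1 h).2⟩

theorem exists_tightTubes_eq {T : Finset (Finset V)} (hT : IsNestedTubing G T) :
    ∃ x ∈ D.polytope, D.tightTubes x = T := by
  have : T ∈ D.tightTubes '' D.polytope := D.image_tightTubes ▸ hT
  exact this

theorem isFace_tubingFace {T : Finset (Finset V)} (hT : IsNestedTubing G T) :
    IsFace D.polytope (D.tubingFace T) := by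
  obtain ⟨x, hx, rfl⟩ := D.exists_tightTubes_eq hT
  rw [tubingFace_eq hT.1]
  exact D.faceLabeling.isFace hx

theorem exists_eq_tubingFace {F : Set (V → ℝ)} (hF : IsFace D.polytope F) :
    ∃ T, IsNestedTubing G T ∧ F = D.tubingFace T := by
  obtain ⟨x, -, hx, rfl⟩ := D.faceLabeling.exists_eq_of_isFace hF
  refine ⟨D.tightTubes x, ?_, ?_⟩
  · have : D.tightTubes x ∈ D.tightTubes '' D.polytope := ⟨x, hx, rfl⟩
    rwa [image_tightTubes] at this
  · rw [tubingFace_eq fun t ht => (mem_tightTubes.1 ht).1]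

theorem image_tightTubes_tubingFace {T : Finset (Finset V)} (hT : IsNestedTubing G T) :
    D.tightTubes '' D.tubingFace T = {T' | IsNestedTubing G T' ∧ T ⊆ T'} := by
  rw [tubingFace_eq hT.1]
  ext T'
  constructor
  · rintro ⟨x, hx, rfl⟩
    have : D.tightTubes x ∈ D.tightTubes '' D.polytope := ⟨x, hx.1, rfl⟩
    exact ⟨by rwa [image_tightTubes] at this, hx.2⟩
  · rintro ⟨h1, h2⟩
    obtain ⟨x, hx, rfl⟩ := D.exists_tightTubes_eq h1
    exact ⟨x, ⟨hx, h2⟩, rfl⟩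

end GraphAssociahedron

/-! ## Facets -/

/-- The exposing functional is constant on `F`; if `F` spanned all directions of `P`, it would be
constant on `P` too, and `F` would be `P`. -/
theorem IsFace.finrank_vectorSpan_lt {E : Type*} [AddCommGroup E] [Module ℝ E] [TopologicalSpace E]
    [FiniteDimensional ℝ E] {P F : Set E} (hF : IsFace P F) (hne : F ≠ P) :
    Module.finrank ℝ (vectorSpan ℝ F) < Module.finrank ℝ (vectorSpan ℝ P) := by
  obtain ⟨⟨x, hx⟩, hex⟩ := hF
  obtain ⟨l, hl⟩ := hex ⟨x, hx⟩
  have hFP : F ⊆ P := by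
    rw [hl]
    exact fun y hy => hy.1
  have hker : vectorSpan ℝ F ≤ LinearMap.ker l.toLinearMap := by
    refine Submodule.span_le.2 ?_
    rintro _ ⟨y, hy, z, hz, rfl⟩
    rw [hl] at hy hz
    have : l y = l z := le_antisymm (hz.2 y hy.1) (hy.2 z hz.1)
    simp [this]
  refine Submodule.finrank_lt_finrank_of_lt
    (lt_of_le_of_ne (vectorSpan_mono ℝ hFP) fun heq => hne (hFP.antisymm fun y hy => ?_))
  have h1 := hker (heq ▸ vsub_mem_vectorSpan ℝ hy (hFP hx))
  have h2 : l y = l x := by simpa [sub_eq_zero] using h1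
  rw [hl] at hx ⊢
  exact ⟨hy, fun z hz => h2 ▸ hx.2 z hz⟩

namespace GraphAssociahedron

variable {V : Type*} [Fintype V] {G : SimpleGraph V} (D : GraphAssociahedron G)

theorem tubingFace_empty : D.tubingFace ∅ = D.polytope := by
  simp [tubingFace]

variable [DecidableEq V]

theorem tubingFace_subset_iff {T T' : Finset (Finset V)} (hT : IsNestedTubing G T)
    (hT' : IsNestedTubing G T') : D.tubingFace T ⊆ D.tubingFace T' ↔ T' ⊆ T := by
  rw [tubingFace_eq hT.1, tubingFace_eq hT'.1]
  constructor
  · intro h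
    obtain ⟨x, hx, rfl⟩ := D.exists_tightTubes_eq hT
    exact (h ⟨hx, le_rfl⟩).2
  · exact fun h x hx => ⟨hx.1, h.trans hx.2⟩

theorem isFacet_tubingFace_singleton {t : Finset V} (ht : IsTube G t) :
    IsFacet D.polytope (D.tubingFace {t}) := by
  have hN := ht.isNestedTubing_singleton
  have hface := D.isFace_tubingFace hN
  refine ⟨hface, ?_⟩
  have hlt : Module.finrank ℝ (vectorSpan ℝ (D.tubingFace {t})) <
      Module.finrank ℝ (vectorSpan ℝ D.polytope) := by
    refine hface.finrank_vectorSpan_lt fun heq => ?_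
    have h0 : IsNestedTubing G ∅ := by
      refine ⟨by simp, fun T' hT' hu => hN.2 T' (hT'.trans (by simp)) hu⟩
    have := (D.tubingFace_subset_iff h0 hN).1 (by rw [tubingFace_empty, heq])
    simp at this
  refine le_antisymm hlt ?_
  set K : Submodule ℝ (V → ℝ) :=
    LinearMap.ker (simplexEquation : (V → ℝ) →ᵃ[ℝ] ℝ).linear with hK
  have hPK : vectorSpan ℝ D.polytope ≤ K := by
    refine Submodule.span_le.2 ?_
    rintro _ ⟨x, hx, y, hy, rfl⟩
    rw [polytope_eq_polyhedron] at hx hy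
    simp only [SetLike.mem_coe, hK, LinearMap.mem_ker]
    rw [AffineMap.linearMap_vsub, hx.1, hy.1, vsub_self]
  -- At a point where only the inequality of `t` is tight, every direction along both the simplex
  -- hyperplane and the hyperplane of `t` stays in the face. Hence the codimension is at most one.
  have hKF : K ⊓ LinearMap.ker (D.normal t) ≤ vectorSpan ℝ (D.tubingFace {t}) := by
    rintro d ⟨hd, hdt⟩
    obtain ⟨x, hx, hxt⟩ := D.exists_tightTubes_eq hN
    have hx' := hx
    rw [polytope_eq_polyhedron] at hx'
    have hev := eventually_add_smul_mem_polyhedron hx' (d := d) hd fun i hi => by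
      change i ∈ cutTight D.normal D.level D.order x at hi
      rw [cutTight_eq hx, hxt] at hi
      obtain rfl : i = Sum.inr t := by simpa using hi
      have : D.normal t d = 0 := hdt
      simp [cutConstraint, this]
    obtain ⟨ε, hε, hpos⟩ := (hev.and self_mem_nhdsWithin).exists
    have hpos : 0 < ε := hpos
    rw [← polytope_eq_polyhedron] at hε
    have hxF : D.normal t x = D.level t := (mem_tightTubes.1 (hxt ▸ Finset.mem_singleton_self t)).2
    have h1 : x ∈ D.tubingFace {t} := ⟨hx, by simpa using hxF⟩
    have h2 : x + ε • d ∈ D.tubingFace {t} := by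
      refine ⟨hε, fun s hs => ?_⟩
      obtain rfl := Finset.mem_singleton.1 hs
      have : D.normal s d = 0 := hdt
      simp [hxF, this]
    have h3 := vsub_mem_vectorSpan ℝ h2 h1
    rw [vsub_eq_sub, add_sub_cancel_left] at h3
    exact (Submodule.smul_mem_iff _ hpos.ne').1 h3
  have h1 := Submodule.finrank_mono hPK
  have h2 := Submodule.finrank_mono hKF
  have h3 := Submodule.finrank_sup_add_finrank_inf_eq K (LinearMap.ker (D.normal t))
  have h4 := Submodule.finrank_le (K ⊔ LinearMap.ker (D.normal t))
  have h5 := (D.normal t).finrank_range_add_finrank_ker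
  have h6 := Submodule.finrank_le (LinearMap.range (D.normal t))
  rw [Module.finrank_self] at h6
  omega

theorem bijOn_tubingFace :
    Set.BijOn D.tubingFace {T | IsKTubing G 1 T} {F | IsFacet D.polytope F} := by
  have hone : ∀ T, IsKTubing G 1 T ↔ ∃ t, IsTube G t ∧ T = {t} := by
    intro T
    constructor
    · rintro ⟨hT, hc⟩
      obtain ⟨t, rfl⟩ := Finset.card_eq_one.1 hc
      exact ⟨t, hT.1 t (Finset.mem_singleton_self t), rfl⟩
    · rintro ⟨t, ht, rfl⟩
      refine ⟨⟨by simpa using ht, ?_⟩, Finset.card_singleton t⟩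
      intro s hs s' hs' hne
      rw [Finset.mem_singleton] at hs hs'
      exact absurd (hs.trans hs'.symm) hne
  refine ⟨?_, ?_, ?_⟩
  · intro T hT
    obtain ⟨t, ht, rfl⟩ := (hone T).1 hT
    exact D.isFacet_tubingFace_singleton ht
  · intro T hT T' hT' heq
    obtain ⟨t, ht, rfl⟩ := (hone T).1 hT
    obtain ⟨t', ht', rfl⟩ := (hone T').1 hT'
    exact ((D.tubingFace_subset_iff ht'.isNestedTubing_singleton
      ht.isNestedTubing_singleton).1 heq.ge).antisymm
      ((D.tubingFace_subset_iff ht.isNestedTubing_singleton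
      ht'.isNestedTubing_singleton).1 heq.le)
  · rintro F ⟨hF, hdim⟩
    obtain ⟨T, hT, rfl⟩ := D.exists_eq_tubingFace hF
    -- The empty tubing gives the whole polytope, which has the wrong dimension. For `t ∈ T` the
    -- given facet lies in the facet of `t`, and equal dimensions make them coincide.
    obtain ⟨t, ht⟩ : T.Nonempty := by
      by_contra hcon
      rw [Finset.not_nonempty_iff_eq_empty.1 hcon, tubingFace_empty] at hdim
      omega
    have htube := hT.1 t ht
    have hN := htube.isNestedTubing_singleton
    have hsub := (D.tubingFace_subset_iff hT hN).2 (by simpa using ht)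
    have hfacet := (D.isFacet_tubingFace_singleton htube).2
    have hface : IsFace (D.tubingFace {t}) (D.tubingFace T) :=
      ⟨hF.1, hF.2.mono (fun x hx => hx.1) hsub⟩
    refine ⟨{t}, (hone _).2 ⟨t, htube, rfl⟩, ?_⟩
    by_contra hne
    have := hface.finrank_vectorSpan_lt (Ne.symm hne)
    omega

end GraphAssociahedron

/-! ## Existence -/

section Existence

variable {V : Type*}

/-- The sum of the coordinates labelled by `t`, which vanishes on the face of `t`. -/
noncomputable def coordinateSum (t : Finset V) : (V → ℝ) →ₗ[ℝ] ℝ := ∑ v ∈ t, LinearMap.proj v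

theorem coordinateSum_apply (t : Finset V) (x : V → ℝ) : coordinateSum t x = ∑ v ∈ t, x v := by
  simp [coordinateSum]

variable [Fintype V]

theorem cutSimplex_congr {normal : Finset V → ((V → ℝ) →ₗ[ℝ] ℝ)} {level level' : Finset V → ℝ}
    {L : List (Finset V)} (h : ∀ t ∈ L, level t = level' t) :
    cutSimplex normal level L = cutSimplex normal level' L := by
  ext x
  exact and_congr_right fun _ => forall₂_congr fun t ht => by rw [h t ht]

variable [DecidableEq V]

theorem finite_extremePoints_cutSimplex (normal : Finset V → ((V → ℝ) →ₗ[ℝ] ℝ))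
    (level : Finset V → ℝ) (L : List (Finset V)) :
    ((cutSimplex normal level L).extremePoints ℝ).Finite := by
  rw [cutSimplex_eq_polyhedron]
  exact faceLabeling_polyhedron.finite_extremePoints

theorem exists_truncatesAt_coordinateSum (level : Finset V → ℝ) (L : List (Finset V))
    (t : Finset V) :
    ∃ c, TruncatesAt (cutSimplex coordinateSum level L)
      (cutSimplex coordinateSum level L ∩ simplexFace t) (coordinateSum t) c := by
  have hfin := finite_extremePoints_cutSimplex coordinateSum level L
  set W := {x ∈ (cutSimplex coordinateSum level L).extremePoints ℝ | 0 < coordinateSum t x}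
    with hW
  have hWfin : W.Finite := hfin.subset fun x hx => hx.1
  -- The coordinate sum vanishes on the face of `t` and is positive at the finitely many other
  -- vertices, so any small positive level separates them.
  have hev : ∀ᶠ c in nhdsWithin (0 : ℝ) (Set.Ioi 0), ∀ x ∈ W, c < coordinateSum t x := by
    refine (Filter.eventually_all_finite hWfin).2 fun x hx => ?_
    exact nhdsWithin_le_nhds (gt_mem_nhds hx.2)
  obtain ⟨c, hc, hpos⟩ := (hev.and self_mem_nhdsWithin).exists
  have hpos : 0 < c := hpos
  refine ⟨c, fun x hx => ⟨fun hxF => ?_, fun hxF => hc x ⟨hx, ?_⟩⟩⟩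
  · rw [coordinateSum_apply, Finset.sum_eq_zero hxF.2.2]
    exact hpos
  · have h0 : ∀ v, 0 ≤ x v := hx.1.1.1
    rw [coordinateSum_apply]
    refine (Finset.sum_nonneg fun v _ => h0 v).lt_of_ne fun heq => hxF ⟨hx.1, hx.1.1, ?_⟩
    exact (Finset.sum_eq_zero_iff_of_nonneg fun v _ => h0 v).1 heq.symm

theorem exists_level {L : List (Finset V)} (hL : L.Nodup) :
    ∃ level : Finset V → ℝ, ∀ (L₁ : List (Finset V)) (t : Finset V) (L₂ : List (Finset V)),
      L = L₁ ++ t :: L₂ →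
        TruncatesAt (cutSimplex coordinateSum level L₁)
          (cutSimplex coordinateSum level L₁ ∩ simplexFace t) (coordinateSum t) (level t) := by
  induction L using List.reverseRecOn with
  | nil => exact ⟨0, fun L₁ t L₂ h => by simp at h⟩
  | append_singleton L s ih =>
    have hs : s ∉ L := fun h => (List.disjoint_of_nodup_append hL) h (by simp)
    obtain ⟨level, hlevel⟩ := ih hL.of_append_left
    obtain ⟨c, hc⟩ := exists_truncatesAt_coordinateSum level L s
    have hupd : ∀ t ∈ L, Function.update level s c t = level t := by
      intro t ht
      exact Function.update_of_ne (by rintro rfl; exact hs ht) _ _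
    refine ⟨Function.update level s c, fun L₁ t L₂ h => ?_⟩
    rcases List.eq_nil_or_concat' L₂ with rfl | ⟨L₂, s', rfl⟩
    · obtain ⟨rfl, h2⟩ := List.append_inj' h rfl
      obtain rfl : s = t := by simpa using h2
      rw [cutSimplex_congr hupd, Function.update_self]
      exact hc
    · rw [← List.cons_append, ← List.append_assoc] at h
      obtain ⟨rfl, -⟩ := List.append_inj' h rfl
      rw [cutSimplex_congr fun u hu => hupd u (by simp [hu]), hupd t (by simp)]
      exact hlevel L₁ t L₂ rfl

theorem GraphAssociahedron.nonempty (G : SimpleGraph V) : Nonempty (GraphAssociahedron G) := by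
  classical
  set L : List (Finset V) :=
    (Finset.univ.filter (IsTube G)).toList.insertionSort fun s t => t.card ≤ s.card with hL
  have hperm := List.perm_insertionSort (fun s t : Finset V => t.card ≤ s.card)
    (Finset.univ.filter (IsTube G)).toList
  have hnodup : L.Nodup := hperm.nodup_iff.2 (Finset.nodup_toList _)
  have htotal : Std.Total fun s t : Finset V => t.card ≤ s.card :=
    ⟨fun s t => le_total t.card s.card⟩
  have htrans : IsTrans (Finset V) fun s t => t.card ≤ s.card :=
    ⟨fun _ _ _ h1 h2 => h2.trans h1⟩
  obtain ⟨level, hlevel⟩ := exists_level hnodup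
  exact ⟨{
    order := L
    nodup := hnodup
    mem_order := fun t => by simp [hL, List.mem_insertionSort]
    sorted := List.pairwise_insertionSort _ _
    normal := coordinateSum
    level := level
    truncates := hlevel }⟩

end Existence

/-! ## Connectedness in the reconnected complement -/

namespace SimpleGraph

variable {V : Type*} {G : SimpleGraph V}

/-- An induced subgraph is connected if every cut of its vertex set is crossed by an edge. -/
theorem induce_connected_iff_forall_cut {S : Set V} :
    (G.induce S).Connected ↔
      S.Nonempty ∧ ∀ U ⊆ S, U.Nonempty → U ≠ S → ∃ a ∈ U, ∃ b ∈ S, b ∉ U ∧ G.Adj a b := by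
  constructor
  · intro h
    refine ⟨Set.nonempty_coe_sort.1 h.nonempty, fun U hU hne hneS => ?_⟩
    obtain ⟨a, ha⟩ := hne
    obtain ⟨b, hbS, hbU⟩ := Set.exists_of_ssubset (hU.ssubset_of_ne hneS)
    obtain ⟨p⟩ := h.preconnected ⟨a, hU ha⟩ ⟨b, hbS⟩
    obtain ⟨d, -, h1, h2⟩ := p.exists_boundary_dart (Subtype.val ⁻¹' U) ha hbU
    exact ⟨d.fst, h1, d.snd, d.snd.2, h2, d.adj⟩
  · rintro ⟨⟨v, hv⟩, h⟩
    rw [connected_iff_exists_forall_reachable]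
    refine ⟨⟨v, hv⟩, ?_⟩
    set U : Set V := {w | ∃ hw : w ∈ S, (G.induce S).Reachable ⟨v, hv⟩ ⟨w, hw⟩} with hU
    by_cases hUS : U = S
    · rintro ⟨w, hw⟩
      obtain ⟨_, hr⟩ : w ∈ U := hUS ▸ hw
      exact hr
    · obtain ⟨a, ⟨haS, har⟩, b, hbS, hbU, hab⟩ :=
        h U (fun w hw => hw.1) ⟨v, hv, Reachable.refl _⟩ hUS
      have hadj : (G.induce S).Adj ⟨a, haS⟩ ⟨b, hbS⟩ := hab
      exact absurd ⟨hbS, har.trans hadj.reachable⟩ hbU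

end SimpleGraph

section ReconnectedComplement

variable {V : Type*} {G : SimpleGraph V} {t : Finset V}

open SimpleGraph

theorem tubeGraph_induce_connected_iff {S : Set {v // v ∈ t}} :
    ((tubeGraph G t).induce S).Connected ↔ (G.induce (Subtype.val '' S)).Connected := by
  simp only [induce_connected_iff_forall_cut, Set.image_nonempty]
  refine and_congr_right fun _ => ⟨fun h U hU hne hneS => ?_, fun h U hU hne hneS => ?_⟩
  · have hUim : Subtype.val '' (Subtype.val ⁻¹' U : Set {v // v ∈ t}) = U := by
      refine Set.image_preimage_eq_of_subset fun v hv => ?_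
      obtain ⟨w, -, rfl⟩ := hU hv
      exact ⟨w, rfl⟩
    obtain ⟨a, ha, b, hb, hbU, hab⟩ := h (Subtype.val ⁻¹' U)
      (by rwa [← Set.image_subset_image_iff Subtype.val_injective, hUim])
      (by rwa [← Set.image_nonempty, hUim]) (by rintro rfl; exact hneS hUim.symm)
    exact ⟨a, ha, b, ⟨b, hb, rfl⟩, hbU, hab⟩
  · obtain ⟨_, ⟨a, ha, rfl⟩, _, ⟨b, hb, rfl⟩, hbU, hab⟩ := h (Subtype.val '' U)
      (Set.image_mono hU) (hne.image _) fun h => hneS (Subtype.val_injective.image_injective h)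
    exact ⟨a, ha, b, hb, fun h => hbU ⟨b, h, rfl⟩, hab⟩

/-- As `t` is connected, `{a, b} ∪ t` is connected without an edge `ab` only if both nodes have a
neighbour in `t`. -/
theorem reconnectedComplement_adj_iff (ht : (G.induce {v | v ∈ t}).Connected)
    {a b : {v // v ∉ t}} : (reconnectedComplement G t).Adj a b ↔
      a ≠ b ∧ (G.Adj a b ∨ (∃ w ∈ t, G.Adj a w) ∧ ∃ w ∈ t, G.Adj b w) := by
  refine and_congr_right fun hab => ?_
  have hab' : (a : V) ≠ b := fun h => hab (Subtype.ext h)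
  constructor
  · rintro (h | h)
    · obtain ⟨x, hx, y, hy, hyx, hxy⟩ := (induce_connected_iff_forall_cut.1 h).2 {a.1}
        (by simp) (by simp) (fun h => hab' (by
          have : b.1 ∈ ({a.1} : Set V) := h ▸ (by simp)
          exact (Set.mem_singleton_iff.1 this).symm))
      obtain rfl := Set.mem_singleton_iff.1 hx
      rcases hy with rfl | rfl
      · exact absurd rfl hyx
      · exact Or.inl hxy
    · have key : ∀ c d : {v // v ∉ t}, (c : V) ≠ d →
          (G.induce (({c.1, d.1} : Set V) ∪ {v | v ∈ t})).Connected →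
          G.Adj c d ∨ ∃ w ∈ t, G.Adj c w := by
        intro c d hcd h
        obtain ⟨x, hx, y, hy, hyx, hxy⟩ := (induce_connected_iff_forall_cut.1 h).2 {c.1}
          (by simp) (by simp) (fun h => hcd (by
            have : d.1 ∈ ({c.1} : Set V) := h ▸ (by simp)
            exact (Set.mem_singleton_iff.1 this).symm))
        obtain rfl := Set.mem_singleton_iff.1 hx
        rcases hy with (rfl | rfl) | hy
        · exact absurd rfl hyx
        · exact Or.inl hxy
        · exact Or.inr ⟨y, hy, hxy⟩
      rcases key a b hab' h with h1 | h1
      · exact Or.inl h1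
      rcases key b a hab'.symm (by rwa [Set.pair_comm]) with h2 | h2
      · exact Or.inl h2.symm
      · exact Or.inr ⟨h1, h2⟩
  · rintro (h | ⟨⟨w, hw, haw⟩, ⟨z, hz, hbz⟩⟩)
    · exact Or.inl (induce_pair_connected_of_adj h)
    · right
      have h1 := induce_union_connected (induce_pair_connected_of_adj haw).preconnected
        ht.preconnected ⟨w, by simp, hw⟩
      have h2 := induce_union_connected (induce_pair_connected_of_adj hbz).preconnected
        h1.preconnected ⟨z, by simp, Or.inr hz⟩
      have e : ({a.1, b.1} : Set V) ∪ {v | v ∈ t} = {b.1, z} ∪ ({a.1, w} ∪ {v | v ∈ t}) := by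
        ext v
        simp only [Set.mem_union, Set.mem_insert_iff, Set.mem_singleton_iff, Set.mem_ofPred_eq]
        constructor
        · rintro ((h | h) | h) <;> simp [h]
        · rintro ((rfl | rfl) | (rfl | rfl) | h) <;> simp [*]
      rwa [e]

/-- New edges shortcut paths through `t`. If no node of `S` has a neighbour in `t`, there are no new
edges inside `S`; otherwise they can be rerouted through the connected set `t`. -/
theorem reconnectedComplement_induce_connected_iff (ht : (G.induce {v | v ∈ t}).Connected)
    {S : Set {v // v ∉ t}} (hS : S.Nonempty) :
    ((reconnectedComplement G t).induce S).Connected ↔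
      (G.induce (Subtype.val '' S)).Connected ∨
        (G.induce (Subtype.val '' S ∪ {v | v ∈ t})).Connected := by
  have hval : ∀ (U : Set {v // v ∉ t}) (v : {v // v ∉ t}), v.1 ∈ Subtype.val '' U ↔ v ∈ U :=
    fun U v => Subtype.val_injective.mem_set_image
  constructor
  · intro h
    have hcut := (induce_connected_iff_forall_cut.1 h).2
    by_cases hex : ∃ a ∈ S, ∃ w ∈ t, G.Adj a w
    · right
      refine induce_connected_iff_forall_cut.2
        ⟨(hS.image _).mono Set.subset_union_left, fun U hU hne hneS => ?_⟩
      obtain ⟨a₀, ha₀, w₀, hw₀, haw₀⟩ := hex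
      by_cases hw : ∃ w ∈ t, w ∈ U
      · by_cases htU : {v | v ∈ t} ⊆ U
        · by_cases hS' : ∃ a ∈ S, a.1 ∈ U
          · obtain ⟨a, ha, haU⟩ := hS'
            obtain ⟨c, hc, d, hd, hdU, hcd⟩ := hcut (S ∩ Subtype.val ⁻¹' U) Set.inter_subset_left
              ⟨a, ha, haU⟩ (by
                intro h
                refine hneS (hU.antisymm (Set.union_subset ?_ htU))
                rintro _ ⟨v, hv, rfl⟩
                exact (h.symm ▸ hv : v ∈ S ∩ Subtype.val ⁻¹' U).2)
            have hdU' : d.1 ∉ U := fun h => hdU ⟨hd, h⟩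
            have hdS : d.1 ∈ Subtype.val '' S ∪ {v | v ∈ t} := Or.inl ⟨d, hd, rfl⟩
            rcases ((reconnectedComplement_adj_iff ht).1 hcd).2 with h1 | ⟨-, w, hw, h1⟩
            · exact ⟨c, hc.2, d, hdS, hdU', h1⟩
            · exact ⟨w, htU hw, d, hdS, hdU', h1.symm⟩
          · push Not at hS'
            exact ⟨w₀, htU hw₀, a₀, Or.inl ⟨a₀, ha₀, rfl⟩, hS' a₀ ha₀, haw₀.symm⟩
        · obtain ⟨w, hwt, hwU⟩ := hw
          obtain ⟨a, ha, b, hb, hbU, hab⟩ := (induce_connected_iff_forall_cut.1 ht).2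
            (U ∩ {v | v ∈ t}) Set.inter_subset_right ⟨w, hwU, hwt⟩
            (fun h => htU (Set.inter_eq_right.1 h))
          exact ⟨a, ha.1, b, Or.inr hb, fun h => hbU ⟨h, hb⟩, hab⟩
      · push Not at hw
        have hUS : ∀ v ∈ U, ∃ a ∈ S, a.1 = v := fun v hv =>
          (hU hv).resolve_right fun h => hw v h hv
        by_cases hSU : Subtype.val '' S ⊆ U
        · exact ⟨a₀, hSU ⟨a₀, ha₀, rfl⟩, w₀, Or.inr hw₀, hw w₀ hw₀, haw₀⟩
        · obtain ⟨u, hu⟩ := hne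
          obtain ⟨a, ha, rfl⟩ := hUS u hu
          obtain ⟨c, hc, d, hd, hdU, hcd⟩ := hcut (S ∩ Subtype.val ⁻¹' U) Set.inter_subset_left
            ⟨a, ha, hu⟩ (by
              intro h
              refine hSU ?_
              rintro _ ⟨v, hv, rfl⟩
              exact (h.symm ▸ hv : v ∈ S ∩ Subtype.val ⁻¹' U).2)
          rcases ((reconnectedComplement_adj_iff ht).1 hcd).2 with h1 | ⟨⟨w, hwt, h1⟩, -⟩
          · exact ⟨c, hc.2, d, Or.inl ⟨d, hd, rfl⟩, fun h => hdU ⟨hd, h⟩, h1⟩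
          · exact ⟨c, hc.2, w, Or.inr hwt, hw w hwt, h1⟩
    · push Not at hex
      left
      refine induce_connected_iff_forall_cut.2 ⟨hS.image _, fun U hU hne hneS => ?_⟩
      obtain ⟨u, hu⟩ := hne
      obtain ⟨a, ha, rfl⟩ := hU hu
      obtain ⟨c, hc, d, hd, hdU, hcd⟩ := hcut (S ∩ Subtype.val ⁻¹' U) Set.inter_subset_left
        ⟨a, ha, hu⟩ (by
          intro h
          refine hneS (hU.antisymm ?_)
          rintro _ ⟨v, hv, rfl⟩
          exact (h.symm ▸ hv : v ∈ S ∩ Subtype.val ⁻¹' U).2)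
      rcases ((reconnectedComplement_adj_iff ht).1 hcd).2 with h1 | ⟨⟨w, hwt, h1⟩, -⟩
      · exact ⟨c, hc.2, d, ⟨d, hd, rfl⟩, fun h => hdU ⟨hd, h⟩, h1⟩
      · exact absurd h1 (hex c hc.1 w hwt)
  · intro h
    refine induce_connected_iff_forall_cut.2 ⟨hS, fun U hU hne hneS => ?_⟩
    have hne' : ∀ a b : {v // v ∉ t}, a ∈ U → b ∉ U → a ≠ b := by
      rintro a _ ha hb rfl
      exact hb ha
    rcases h with h | h
    · obtain ⟨_, ⟨a, ha, rfl⟩, _, ⟨b, hb, rfl⟩, hbU, hab⟩ :=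
        (induce_connected_iff_forall_cut.1 h).2 (Subtype.val '' U)
        (Set.image_mono hU) (hne.image _) fun h => hneS (Subtype.val_injective.image_injective h)
      rw [hval] at hbU
      exact ⟨a, ha, b, hb, hbU, (reconnectedComplement_adj_iff ht).2 ⟨hne' a b ha hbU, Or.inl hab⟩⟩
    · have hcut := (induce_connected_iff_forall_cut.1 h).2
      obtain ⟨w, hw⟩ := Set.nonempty_coe_sort.1 ht.nonempty
      have hproper : ∀ W : Set {v // v ∉ t},
          Subtype.val '' W ≠ Subtype.val '' S ∪ {v | v ∈ t} := by
        intro W h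
        obtain ⟨v, -, hv⟩ : w ∈ Subtype.val '' W := h ▸ Or.inr hw
        exact v.2 (hv ▸ hw)
      obtain ⟨_, ⟨a, ha, rfl⟩, b, hb, hbU, hab⟩ := hcut (Subtype.val '' U)
        ((Set.image_mono hU).trans Set.subset_union_left) (hne.image _) (hproper U)
      obtain ⟨e, heS, heU⟩ := Set.exists_of_ssubset (hU.ssubset_of_ne hneS)
      -- Edges of `G` leave both `U` and `S \ U`. If neither joins the two sides, both end in `t`,
      -- and the reconnected complement joins their starting points.
      obtain ⟨_, ⟨c, ⟨hcS, hcU⟩, rfl⟩, d, hd, hdU, hcd⟩ := hcut (Subtype.val '' (S \ U))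
        ((Set.image_mono Set.sdiff_subset).trans Set.subset_union_left)
        (Set.Nonempty.image _ ⟨e, heS, heU⟩) (hproper _)
      rcases hb with ⟨b, hb, rfl⟩ | hb
      · rw [hval] at hbU
        exact ⟨a, ha, b, hb, hbU,
          (reconnectedComplement_adj_iff ht).2 ⟨hne' a b ha hbU, Or.inl hab⟩⟩
      · rcases hd with ⟨d, hd, rfl⟩ | hd
        · rw [hval] at hdU
          have hdU : d ∈ U := by
            by_contra hcon
            exact hdU ⟨hd, hcon⟩
          exact ⟨d, hdU, c, hcS, hcU,
            (reconnectedComplement_adj_iff ht).2 ⟨hne' d c hdU hcU, Or.inl hcd.symm⟩⟩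
        · exact ⟨a, ha, c, hcS, hcU, (reconnectedComplement_adj_iff ht).2
            ⟨hne' a c ha hcU, Or.inr ⟨⟨b, hb, hab⟩, d, hd, hcd⟩⟩⟩

end ReconnectedComplement

/-! ## Nested tubings containing a given tube -/

section Link

variable {V : Type*}

/-- The image of a set of nodes of a subtype. -/
abbrev Finset.vals {p : V → Prop} (s : Finset {v // p v}) : Finset V :=
  s.map (Function.Embedding.subtype p)

theorem Finset.coe_vals {p : V → Prop} (s : Finset {v // p v}) :
    {v | v ∈ s.vals} = Subtype.val '' {v | v ∈ s} := by
  ext v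
  simp

variable [DecidableEq V] {G : SimpleGraph V} {t : Finset V}

open Classical in
/-- The tube of `G` corresponding to a tube of the reconnected complement of `t`. -/
noncomputable def liftTube (G : SimpleGraph V) (t : Finset V) (s : Finset {v // v ∉ t}) :
    Finset V :=
  if (G.induce {v | v ∈ s.vals ∪ t}).Connected then s.vals ∪ t else s.vals

theorem liftTube_of_connected {s : Finset {v // v ∉ t}}
    (h : (G.induce {v | v ∈ s.vals ∪ t}).Connected) : liftTube G t s = s.vals ∪ t := if_pos h

theorem liftTube_of_not_connected {s : Finset {v // v ∉ t}}
    (h : ¬ (G.induce {v | v ∈ s.vals ∪ t}).Connected) : liftTube G t s = s.vals := if_neg h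

theorem coe_mem_liftTube {s : Finset {v // v ∉ t}} {v : {v // v ∉ t}} :
    v.1 ∈ liftTube G t s ↔ v ∈ s := by
  rw [liftTube]
  split_ifs <;> simp [v.2]

theorem liftTube_injective : Function.Injective (liftTube G t) := fun s s' h => by
  ext v
  rw [← coe_mem_liftTube (G := G), h, coe_mem_liftTube]

theorem liftTube_subset {s : Finset {v // v ∉ t}} : liftTube G t s ⊆ s.vals ∪ t := by
  rw [liftTube]
  split_ifs
  · rfl
  · exact Finset.subset_union_left

theorem not_liftTube_subset {s : Finset {v // v ∉ t}} (hs : s.Nonempty) :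
    ¬ liftTube G t s ⊆ t := fun h => by
  obtain ⟨v, hv⟩ := hs
  exact v.2 (h (coe_mem_liftTube.2 hv))

theorem vals_subtype_union (u : Finset V) :
    (u.subtype (· ∉ t)).vals ∪ t = u ∪ t := by
  ext v
  simp only [Finset.subtype_map, Finset.mem_union, Finset.mem_filter]
  tauto

/-- The tubes of a tubing that are contained in `t`. -/
noncomputable def innerTubes (t : Finset V) (T : Finset (Finset V)) :
    Finset (Finset {v // v ∈ t}) :=
  Finset.univ.filter fun s => s.vals ∈ T ∧ s.vals ≠ t

theorem mem_innerTubes {T : Finset (Finset V)} {s : Finset {v // v ∈ t}} :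
    s ∈ innerTubes t T ↔ s.vals ∈ T ∧ s.vals ≠ t := by
  simp [innerTubes]

theorem sup_image_vals {p : V → Prop} (T : Finset (Finset {v // p v})) :
    (T.image Finset.vals).sup id = (T.sup id).vals := by
  ext v
  simp only [Finset.mem_sup, Finset.mem_image, id, Finset.mem_map]
  constructor
  · rintro ⟨_, ⟨s, hs, rfl⟩, hv⟩
    obtain ⟨w, hw, rfl⟩ := Finset.mem_map.1 hv
    exact ⟨w, ⟨s, hs, hw⟩, rfl⟩
  · rintro ⟨w, ⟨s, hs, hw⟩, rfl⟩
    exact ⟨_, ⟨s, hs, rfl⟩, Finset.mem_map_of_mem _ hw⟩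

variable [Fintype V]

/-! ### Tubes of the induced subgraph and of the reconnected complement -/

theorem isTube_tubeGraph_iff {s : Finset {v // v ∈ t}} (ht : IsTube G t) :
    IsTube (tubeGraph G t) s ↔ IsTube G s.vals ∧ s.vals ≠ t := by
  have h1 : s = Finset.univ ↔ s.vals = t := by
    have : (Finset.univ : Finset {v // v ∈ t}).vals = t := by
      ext v
      simp
    exact ⟨by rintro rfl; exact this, fun h => Finset.map_injective _ (h.trans this.symm)⟩
  have h2 : s.vals ≠ Finset.univ := by
    intro h
    refine ht.2.1 (Finset.eq_univ_of_forall fun v => ?_)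
    obtain ⟨w, -, rfl⟩ := Finset.mem_map.1 (h ▸ Finset.mem_univ v)
    exact w.2
  rw [IsTube, IsTube, tubeGraph_induce_connected_iff, Finset.coe_vals, Finset.map_nonempty, Ne, h1]
  tauto

theorem isTube_reconnectedComplement_iff {s : Finset {v // v ∉ t}} (ht : IsTube G t) :
    IsTube (reconnectedComplement G t) s ↔ s.Nonempty ∧ s.vals ∪ t ≠ Finset.univ ∧
      ((G.induce {v | v ∈ s.vals}).Connected ∨ (G.induce {v | v ∈ s.vals ∪ t}).Connected) := by
  have h1 : s = Finset.univ ↔ s.vals ∪ t = Finset.univ := by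
    simp only [Finset.eq_univ_iff_forall, Finset.mem_union, Finset.mem_map, Subtype.forall]
    refine forall_congr' fun v => ?_
    by_cases hv : v ∈ t <;> simp [hv]
  rw [IsTube, Ne, h1]
  refine and_congr_right fun hs => and_congr_right fun _ => ?_
  rw [reconnectedComplement_induce_connected_iff (S := {v | v ∈ s}) ht.2.2 hs, ← Finset.coe_vals]
  have e : {v | v ∈ s.vals} ∪ {v | v ∈ t} = {v | v ∈ s.vals ∪ t} := by
    ext v
    simp
  rw [e]

/-! ### Splitting a nested tubing along `t` and gluing it back -/

/-- The tubes of the reconnected complement of `t` induced by a tubing. -/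
noncomputable def outerTubes (G : SimpleGraph V) (t : Finset V) (T : Finset (Finset V)) :
    Finset (Finset {v // v ∉ t}) :=
  Finset.univ.filter fun s => s.Nonempty ∧ liftTube G t s ∈ T

open Classical in
/-- The tubing consisting of `t`, tubes in `t` and lifted tubes of the reconnected complement. -/
noncomputable def glueTubes (G : SimpleGraph V) (t : Finset V)
    (T₁ : Finset (Finset {v // v ∈ t})) (T₂ : Finset (Finset {v // v ∉ t})) :
    Finset (Finset V) :=
  Finset.univ.filter fun u => u = t ∨ (∃ s ∈ T₁, s.vals = u) ∨ ∃ s ∈ T₂, liftTube G t s = u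

theorem mem_outerTubes {T : Finset (Finset V)} {s : Finset {v // v ∉ t}} :
    s ∈ outerTubes G t T ↔ s.Nonempty ∧ liftTube G t s ∈ T := by
  simp [outerTubes]

theorem mem_glueTubes {T₁ : Finset (Finset {v // v ∈ t})} {T₂ : Finset (Finset {v // v ∉ t})}
    {u : Finset V} : u ∈ glueTubes G t T₁ T₂ ↔
      u = t ∨ (∃ s ∈ T₁, s.vals = u) ∨ ∃ s ∈ T₂, liftTube G t s = u := by
  simp [glueTubes]

theorem IsNestedTubing.innerTubes {T : Finset (Finset V)} (hT : IsNestedTubing G T)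
    (ht : t ∈ T) : IsNestedTubing (tubeGraph G t) (innerTubes t T) := by
  have htube := hT.1 t ht
  refine ⟨fun s hs => ?_, fun T' hT' hu => ?_⟩
  · rw [mem_innerTubes] at hs
    exact (isTube_tubeGraph_iff htube).2 ⟨hT.1 _ hs.1, hs.2⟩
  · have h1 : IsTube G ((T'.image Finset.vals).sup id) := by
      rw [sup_image_vals]
      rcases hu with hu | hu
      · exact ((isTube_tubeGraph_iff htube).1 hu).1
      · have e : (Finset.univ : Finset {v // v ∈ t}).vals = t := by
          ext v
          simp
        rwa [hu, e]
    have h2 := hT.2 (T'.image Finset.vals) (fun u hu => by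
      obtain ⟨s, hs, rfl⟩ := Finset.mem_image.1 hu
      exact (mem_innerTubes.1 (hT' hs)).1) (Or.inl h1)
    rw [sup_image_vals] at h2
    obtain ⟨s, hs, h⟩ := Finset.mem_image.1 h2
    rwa [← Finset.map_injective _ h]

theorem IsNestedTubing.outerTubes {T : Finset (Finset V)} (hT : IsNestedTubing G T)
    (ht : t ∈ T) : IsNestedTubing (reconnectedComplement G t) (outerTubes G t T) := by
  have htube := hT.1 t ht
  refine ⟨fun s hs => ?_, fun T' hT' hu => ?_⟩
  · rw [mem_outerTubes] at hs
    have hlift := hT.1 _ hs.2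
    rw [isTube_reconnectedComplement_iff htube]
    by_cases hc : (G.induce {v | v ∈ s.vals ∪ t}).Connected
    · rw [liftTube_of_connected hc] at hlift
      exact ⟨hs.1, hlift.2.1, Or.inr hc⟩
    · rw [liftTube_of_not_connected hc] at hlift
      refine ⟨hs.1, fun hun => ?_, Or.inl hlift.2.2⟩
      have h1 := hT.2 {t, liftTube G t s} (by
        rw [Finset.insert_subset_iff, Finset.singleton_subset_iff]
        exact ⟨ht, hs.2⟩) (Or.inr (by
          rw [liftTube_of_not_connected hc, Finset.sup_insert, Finset.sup_singleton, id, id,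
            Finset.sup_eq_union, Finset.union_comm, hun]))
      have e : ({t, liftTube G t s} : Finset (Finset V)).sup id = Finset.univ := by
        rw [liftTube_of_not_connected hc, Finset.sup_insert, Finset.sup_singleton, id, id,
            Finset.sup_eq_union, Finset.union_comm, hun]
      rw [e, Finset.mem_insert, Finset.mem_singleton] at h1
      rcases h1 with h1 | h1
      · exact htube.2.1 h1.symm
      · rw [liftTube_of_not_connected hc] at h1
        exact hlift.2.1 h1.symm
  · have hne : (T'.sup id).Nonempty := by
      rcases hu with hu | hu
      · exact hu.1
      · obtain ⟨v, hv⟩ : ∃ v, v ∉ t := by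
          by_contra! hcon
          exact htube.2.1 (Finset.eq_univ_of_forall hcon)
        exact ⟨⟨v, hv⟩, hu ▸ Finset.mem_univ _⟩
    have hle : ∀ s ∈ T', s ⊆ T'.sup id := fun s hs => Finset.le_sup (f := id) hs
    have hlift : T'.image (liftTube G t) ⊆ T := fun u hu => by
      obtain ⟨s, hs, rfl⟩ := Finset.mem_image.1 hu
      exact (mem_outerTubes.1 (hT' hs)).2
    have hcoe : ∀ v : {v // v ∉ t}, v ∈ T'.sup id ↔ ∃ s ∈ T', v ∈ s := fun v => by
      simp [Finset.mem_sup]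
    -- In the first case nestedness is applied to the lifted members together with `t`. In the
    -- second, no member is lifted by adding `t`, so the lifted members alone have the connected
    -- union `(T'.sup id).vals`.
    by_cases hcase : IsTube G ((T'.sup id).vals ∪ t) ∨ (T'.sup id).vals ∪ t = Finset.univ
    · have e : (insert t (T'.image (liftTube G t))).sup id = (T'.sup id).vals ∪ t := by
        refine le_antisymm (Finset.sup_le fun u hu => ?_) ?_
        · rcases Finset.mem_insert.1 hu with rfl | hu
          · exact Finset.subset_union_right
          · obtain ⟨s, hs, rfl⟩ := Finset.mem_image.1 hu
            exact liftTube_subset.trans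
              (Finset.union_subset_union_left (Finset.map_subset_map.2 (hle s hs)))
        · refine Finset.union_subset (fun v hv => ?_)
            (Finset.le_sup (f := id) (Finset.mem_insert_self _ _))
          obtain ⟨w, hw, rfl⟩ := Finset.mem_map.1 hv
          obtain ⟨s, hs, hws⟩ := (hcoe w).1 hw
          exact Finset.mem_sup.2 ⟨liftTube G t s,
            Finset.mem_insert_of_mem (Finset.mem_image_of_mem _ hs), coe_mem_liftTube.2 hws⟩
      have h1 := hT.2 _ (Finset.insert_subset ht hlift) (by rwa [e])
      rw [e] at h1
      rcases Finset.mem_insert.1 h1 with h1 | h1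
      · obtain ⟨v, hv⟩ := hne
        exact absurd (h1.subset (Finset.mem_union_left t (Finset.mem_map_of_mem _ hv))) v.2
      · obtain ⟨s, hs, h⟩ := Finset.mem_image.1 h1
        have : s = T'.sup id := by
          ext v
          rw [← coe_mem_liftTube (G := G), h]
          simp [v.2]
        rwa [← this]
    · push Not at hcase
      have hnc : ¬ (G.induce {v | v ∈ (T'.sup id).vals ∪ t}).Connected := fun h =>
        hcase.1 ⟨htube.1.mono Finset.subset_union_right, hcase.2, h⟩
      have hu' : IsTube (reconnectedComplement G t) (T'.sup id) := by
        refine hu.resolve_right fun h => hcase.2 (Finset.eq_univ_of_forall fun v => ?_)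
        by_cases hv : v ∈ t
        · exact Finset.mem_union_right _ hv
        · exact Finset.mem_union_left _
            (Finset.mem_map.2 ⟨⟨v, hv⟩, h ▸ Finset.mem_univ _, rfl⟩)
      rw [isTube_reconnectedComplement_iff htube] at hu'
      have hconn := hu'.2.2.resolve_right hnc
      have hsl : ∀ s ∈ T', liftTube G t s = s.vals := by
        intro s hs
        refine liftTube_of_not_connected fun h => hnc ?_
        obtain ⟨v, hv⟩ := (mem_outerTubes.1 (hT' hs)).1
        have h2 := SimpleGraph.induce_finset_union_connected h hconn ⟨v.1, Finset.mem_inter.2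
          ⟨Finset.mem_union_left _ (Finset.mem_map_of_mem _ hv),
            Finset.mem_map_of_mem _ (hle s hs hv)⟩⟩
        rwa [Finset.union_right_comm,
          Finset.union_eq_right.2 (Finset.map_subset_map.2 (hle s hs))] at h2
      have e : T'.image (liftTube G t) = T'.image Finset.vals := Finset.image_congr hsl
      have h1 := hT.2 _ hlift (by
        rw [e, sup_image_vals]
        refine Or.inl ⟨by simpa using hne, fun h => ?_, hconn⟩
        exact hcase.2 (by rw [h, Finset.union_eq_left.2 (Finset.subset_univ _)]))
      rw [e, sup_image_vals] at h1
      obtain ⟨s, hs, h⟩ := Finset.mem_image.1 h1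
      rwa [← Finset.map_injective _ h]

theorem IsNestedTubing.glueTubes {T₁ : Finset (Finset {v // v ∈ t})}
    {T₂ : Finset (Finset {v // v ∉ t})} (ht : IsTube G t)
    (h₁ : IsNestedTubing (tubeGraph G t) T₁)
    (h₂ : IsNestedTubing (reconnectedComplement G t) T₂) :
    IsNestedTubing G (glueTubes G t T₁ T₂) := by
  refine ⟨fun u hu => ?_, fun T' hT' hu => ?_⟩
  · rcases mem_glueTubes.1 hu with rfl | ⟨s, hs, rfl⟩ | ⟨s, hs, rfl⟩
    · exact ht
    · exact ((isTube_tubeGraph_iff ht).1 (h₁.1 s hs)).1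
    · have hs' := (isTube_reconnectedComplement_iff ht).1 (h₂.1 s hs)
      refine ⟨?_, fun h => hs'.2.1 ?_, ?_⟩
      · obtain ⟨v, hv⟩ := hs'.1
        exact ⟨v, coe_mem_liftTube.2 hv⟩
      · exact Finset.univ_subset_iff.1 (h ▸ liftTube_subset)
      · by_cases hc : (G.induce {v | v ∈ s.vals ∪ t}).Connected
        · rwa [liftTube_of_connected hc]
        · rw [liftTube_of_not_connected hc]
          exact hs'.2.2.resolve_right hc
  · have hle : ∀ s ∈ T', s ⊆ T'.sup id := fun s hs => Finset.le_sup (f := id) hs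
    -- If the union lies in `t`, no lifted tube is involved and the subgraph decides. Otherwise the
    -- part `w` of the union outside `t` is the union of the tubes whose lifts are in `T'`, and the
    -- complement decides.
    by_cases hut : T'.sup id ⊆ t
    · have hutube : IsTube G (T'.sup id) :=
        hu.resolve_right fun h => ht.2.1 (Finset.univ_subset_iff.1 (h ▸ hut))
      by_cases htT : t ∈ T'
      · rwa [hut.antisymm (hle t htT)]
      set T₁' := T₁.filter fun s => s.vals ∈ T' with hT₁'
      have e : T₁'.image Finset.vals = T' := by
        ext u
        simp only [Finset.mem_image, hT₁', Finset.mem_filter]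
        constructor
        · rintro ⟨s, hs, rfl⟩
          exact hs.2
        · intro hu
          rcases mem_glueTubes.1 (hT' hu) with rfl | ⟨s, hs, rfl⟩ | ⟨s, hs, rfl⟩
          · exact absurd hu htT
          · exact ⟨s, ⟨hs, hu⟩, rfl⟩
          · exact absurd ((hle _ hu).trans hut) (not_liftTube_subset (h₂.1 s hs).1)
      have e' : (T₁'.sup id).vals = T'.sup id := by rw [← sup_image_vals, e]
      have h := h₁.2 T₁' (Finset.filter_subset _ _) (by
        by_cases htu : (T₁'.sup id).vals = t
        · right
          refine Finset.eq_univ_of_forall fun v => ?_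
          obtain ⟨w, hw, hwv⟩ := Finset.mem_map.1 (htu.symm ▸ v.2 : v.1 ∈ (T₁'.sup id).vals)
          rwa [← Subtype.ext hwv]
        · left
          exact (isTube_tubeGraph_iff ht).2 ⟨e' ▸ hutube, htu⟩)
      rw [← e']
      exact (Finset.mem_filter.1 h).2
    · set w := (T'.sup id).subtype (· ∉ t) with hw
      have hmem : ∀ v : {v // v ∉ t}, v ∈ w ↔ v.1 ∈ T'.sup id := fun v => by simp [hw]
      have hwne : w.Nonempty := by
        obtain ⟨v, hv, hvt⟩ := Finset.not_subset.1 hut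
        exact ⟨⟨v, hvt⟩, (hmem _).2 hv⟩
      have hwt : w.vals ∪ t = T'.sup id ∪ t := vals_subtype_union _
      have hdisj : ¬ (T'.sup id ∩ t).Nonempty → w.vals = T'.sup id := by
        intro h
        ext v
        simp only [hw, Finset.subtype_map, Finset.mem_filter, and_iff_left_iff_imp]
        exact fun hv hvt => h ⟨v, Finset.mem_inter.2 ⟨hv, hvt⟩⟩
      set T₂' := T₂.filter fun s => liftTube G t s ∈ T' with hT₂'
      have e : T₂'.sup id = w := by
        ext v
        rw [hmem]
        simp only [Finset.mem_sup, id, hT₂', Finset.mem_filter]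
        constructor
        · rintro ⟨s, hs, hv⟩
          exact ⟨_, hs.2, coe_mem_liftTube.2 hv⟩
        · rintro ⟨u, hu, hv⟩
          rcases mem_glueTubes.1 (hT' hu) with rfl | ⟨s, hs, rfl⟩ | ⟨s, hs, rfl⟩
          · exact absurd hv v.2
          · obtain ⟨x, -, hx⟩ := Finset.mem_map.1 hv
            exact absurd (hx ▸ x.2) v.2
          · exact ⟨s, ⟨hs, hu⟩, coe_mem_liftTube.1 hv⟩
      have h := h₂.2 T₂' (Finset.filter_subset _ _) (by
        rw [e]
        by_cases hun : T'.sup id ∪ t = Finset.univ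
        · right
          refine Finset.eq_univ_of_forall fun v => (hmem v).2 ?_
          exact (Finset.mem_union.1 (hun.symm ▸ Finset.mem_univ v.1)).resolve_right v.2
        · left
          have hutube : IsTube G (T'.sup id) := hu.resolve_right fun h => hun (by
            rw [h, Finset.union_eq_left.2 (Finset.subset_univ _)])
          rw [isTube_reconnectedComplement_iff ht, hwt]
          refine ⟨hwne, hun, ?_⟩
          by_cases hi : (T'.sup id ∩ t).Nonempty
          · exact Or.inr (SimpleGraph.induce_finset_union_connected hutube.2.2 ht.2.2 hi)
          · left
            rw [hdisj hi]
            exact hutube.2.2)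
      rw [e] at h
      obtain ⟨hwT₂, hwT'⟩ := Finset.mem_filter.1 h
      -- If `w ∪ t` is connected, it is the lift of `w`, a member of `T'`, so the union already
      -- contains `t`. Otherwise the union, being connected, cannot meet `t`.
      have hlw : liftTube G t w = T'.sup id := by
        have hutube : IsTube G (T'.sup id) := hu.resolve_right fun h =>
          (h₂.1 w hwT₂).2.1 (Finset.eq_univ_of_forall fun v => (hmem v).2 (h ▸ Finset.mem_univ _))
        by_cases hc : (G.induce {v | v ∈ w.vals ∪ t}).Connected
        · have := hle _ hwT'
          rw [liftTube_of_connected hc, hwt] at this ⊢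
          exact this.antisymm Finset.subset_union_left
        · rw [liftTube_of_not_connected hc]
          refine hdisj fun hi => hc ?_
          rw [hwt]
          exact SimpleGraph.induce_finset_union_connected hutube.2.2 ht.2.2 hi
      rwa [← hlw]

/-- Nestedness of the pair `{u, t}` leaves two cases: `u` contains `t`, or `u ∪ t` is disconnected
and `u` is disjoint from `t`. The lift restores `u` in both. -/
theorem IsNestedTubing.liftTube_subtype {T : Finset (Finset V)} (hT : IsNestedTubing G T)
    (ht : t ∈ T) {u : Finset V} (hu : u ∈ T) (hut : ¬ u ⊆ t) :
    liftTube G t (u.subtype (· ∉ t)) = u := by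
  have htube := hT.1 t ht
  have key : (G.induce {v | v ∈ u ∪ t}).Connected → u ∪ t = u := by
    intro hc
    have e : ({u, t} : Finset (Finset V)).sup id = u ∪ t := by
      rw [Finset.sup_insert, Finset.sup_singleton]
      rfl
    have h := hT.2 {u, t} (by
      rw [Finset.insert_subset_iff, Finset.singleton_subset_iff]
      exact ⟨hu, ht⟩) (by
        rw [e]
        by_cases hun : u ∪ t = Finset.univ
        · exact Or.inr hun
        · exact Or.inl ⟨htube.1.mono Finset.subset_union_right, hun, hc⟩)
    rw [e, Finset.mem_insert, Finset.mem_singleton] at h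
    exact h.resolve_right fun h => hut (Finset.union_eq_right.1 h)
  by_cases hc : (G.induce {v | v ∈ u ∪ t}).Connected
  · rw [liftTube_of_connected (by rwa [vals_subtype_union]), vals_subtype_union, key hc]
  · rw [liftTube_of_not_connected (by rwa [vals_subtype_union])]
    ext v
    simp only [Finset.subtype_map, Finset.mem_filter, and_iff_left_iff_imp]
    exact fun hv hvt => hc (SimpleGraph.induce_finset_union_connected (hT.1 u hu).2.2 htube.2.2
      ⟨v, Finset.mem_inter.2 ⟨hv, hvt⟩⟩)

/-- The nested tubings containing `t` are the pairs of a nested tubing of the subgraph induced by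
`t` and of a nested tubing of the reconnected complement of `t`. -/
noncomputable def linkOrderIso (ht : IsTube G t) :
    {T | IsNestedTubing G T ∧ {t} ⊆ T} ≃o
      {T | IsNestedTubing (tubeGraph G t) T} ×ˢ
        {T | IsNestedTubing (reconnectedComplement G t) T} :=
  Equiv.toOrderIso
    { toFun := fun T => ⟨(innerTubes t T.1, outerTubes G t T.1),
        T.2.1.innerTubes (Finset.singleton_subset_iff.1 T.2.2),
        T.2.1.outerTubes (Finset.singleton_subset_iff.1 T.2.2)⟩
      invFun := fun T => ⟨glueTubes G t T.1.1 T.1.2, IsNestedTubing.glueTubes ht T.2.1 T.2.2,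
        Finset.singleton_subset_iff.2 (mem_glueTubes.2 (Or.inl rfl))⟩
      left_inv := by
        rintro ⟨T, hT, htT⟩
        rw [Finset.singleton_subset_iff] at htT
        refine Subtype.ext (Finset.ext fun u => ?_)
        simp only [mem_glueTubes, mem_innerTubes, mem_outerTubes]
        constructor
        · rintro (rfl | ⟨s, hs, rfl⟩ | ⟨s, hs, rfl⟩)
          · exact htT
          · exact hs.1
          · exact hs.2
        · intro hu
          by_cases hut : u = t
          · exact Or.inl hut
          by_cases husub : u ⊆ t
          · have e : (u.subtype (· ∈ t)).vals = u := Finset.subtype_map_of_mem husub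
            exact Or.inr (Or.inl ⟨u.subtype (· ∈ t), by rw [e]; exact ⟨hu, hut⟩, e⟩)
          · have e := hT.liftTube_subtype htT hu husub
            refine Or.inr (Or.inr ⟨u.subtype (· ∉ t), ⟨?_, by rwa [e]⟩, e⟩)
            obtain ⟨v, hv, hvt⟩ := Finset.not_subset.1 husub
            exact ⟨⟨v, hvt⟩, by simpa using hv⟩
      right_inv := by
        rintro ⟨⟨T₁, T₂⟩, h₁, h₂⟩
        have hval : ∀ s : Finset {v // v ∈ t}, s.vals ⊆ t := fun s v hv => by
          obtain ⟨x, -, rfl⟩ := Finset.mem_map.1 hv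
          exact x.2
        refine Subtype.ext (Prod.ext (Finset.ext fun s => ?_) (Finset.ext fun s => ?_))
        · simp only [mem_innerTubes, mem_glueTubes]
          constructor
          · rintro ⟨h | ⟨s', hs', h⟩ | ⟨s', hs', h⟩, hne⟩
            · exact absurd h hne
            · rwa [← Finset.map_injective _ h]
            · exact absurd (h ▸ hval s) (not_liftTube_subset (h₂.1 s' hs').1)
          · exact fun hs => ⟨Or.inr (Or.inl ⟨s, hs, rfl⟩),
              ((isTube_tubeGraph_iff ht).1 (h₁.1 s hs)).2⟩
        · simp only [mem_outerTubes, mem_glueTubes]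
          constructor
          · rintro ⟨hne, h | ⟨s', hs', h⟩ | ⟨s', hs', h⟩⟩
            · exact absurd h.subset (not_liftTube_subset hne)
            · exact absurd (h ▸ hval s') (not_liftTube_subset hne)
            · rwa [← liftTube_injective h]
          · exact fun hs => ⟨(h₂.1 s hs).1, Or.inr (Or.inr ⟨s, hs, rfl⟩)⟩ }
    (fun T T' h => by
      refine ⟨fun s hs => ?_, fun s hs => ?_⟩
      · exact mem_innerTubes.2 ((mem_innerTubes.1 hs).imp_left fun h' => h h')
      · exact mem_outerTubes.2 ((mem_outerTubes.1 hs).imp_right fun h' => h h'))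
    (fun T T' h u hu => by
      refine mem_glueTubes.2 ((mem_glueTubes.1 hu).imp_right (Or.imp ?_ ?_))
      · exact fun ⟨s, hs, e⟩ => ⟨s, h.1 hs, e⟩
      · exact fun ⟨s, hs, e⟩ => ⟨s, h.2 hs, e⟩)

end Link

theorem GraphAssociahedron.combinatoriallyEquivalent_tubingFace {V : Type*} [Fintype V]
    [DecidableEq V] {G : SimpleGraph V} (D : GraphAssociahedron G) {t : Finset V}
    (ht : IsTube G t) (D₁ : GraphAssociahedron (tubeGraph G t))
    (D₂ : GraphAssociahedron (reconnectedComplement G t)) :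
    CombinatoriallyEquivalent (D.tubingFace {t}) (D₁.polytope ×ˢ D₂.polytope) := by
  have hN := ht.isNestedTubing_singleton
  refine (D.faceLabeling.of_isFace (D.isFace_tubingFace hN)).combinatoriallyEquivalent
    (D₁.faceLabeling.prod D₂.faceLabeling) ?_
  rw [Set.prodMap_image_prod, D.image_tightTubes_tubingFace hN, D₁.image_tightTubes,
    D₂.image_tightTubes]
  exact linkOrderIso ht

theorem theorem2p9 {V : Type*} [Fintype V] [DecidableEq V] (G : SimpleGraph V) :
    Nonempty (GraphAssociahedron G) ∧
    ∀ D : GraphAssociahedron G,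
      Set.BijOn D.tubingFace {T | IsKTubing G 1 T} {F | IsFacet D.polytope F} ∧
      ∀ t : Finset V, IsTube G t →
        ∀ (D₁ : GraphAssociahedron (tubeGraph G t))
          (D₂ : GraphAssociahedron (reconnectedComplement G t)),
          CombinatoriallyEquivalent (D.tubingFace {t}) (D₁.polytope ×ˢ D₂.polytope) :=
  ⟨GraphAssociahedron.nonempty G, fun D => ⟨D.bijOn_tubingFace, fun _ ht D₁ D₂ =>
    D.combinatoriallyEquivalent_tubingFace ht D₁ D₂⟩⟩
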